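/- **Conventions.** $\mathbb N=\{1,2,\dots\}$; $c_{00}$ is the space of finitely supported real sequences on $\mathbb N$ with unit vectors $e_n$; $f\in c_{00}$ acts on $x\in c_{00}$ by $f(x)=\sum_i f(i)x(i)$; $\operatorname{ran}f$ is the smallest interval of $\mathbb N$ containing $\operatorname{supp}f$; $Ef$ is the restriction of $f$ to the interval $E\subset\mathbb N$; $f<g$ means that $f,g\ne0$ and $\max\operatorname{supp}f<\min\operatorname{supp}g$; $\|f\|_0=\max_i|f(i)|$. The Schreier families are $\mathcal S_0=\{\{n\}:n\in\mathbb N\}$, $\mathcal S_1=\{F:\#F\le\min F\}$, $\mathcal S_{n+1}=\{\bigcup_{j=1}^kF_j: F_1<\dots<F_k\in\mathcal S_n,\ k\le\min F_1\}$. A sequence $f_1<f_2<\cdots$ is $\mathcal S_n$-admissible if $\{\min\operatorname{supp}f_j\}_j\in\mathcal S_n$. **Choices.** Fix a set $L_0=\{\ell_1,\ell_2,\dots\}\subset\mathbb N$ with $\ell_1>9$, $\ell_{k+1}>2^{2\ell_k}$, $\sum_k2^{-\ell_k}<\frac1{1000}$; a partition of $L_0$ into infinite sets $L_1,L_2,L_3$;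 and a one-to-one $\sigma:\mathcal Q\to L_2$, where $\mathcal Q$ is the set of finite sequences $f_1<\dots<f_m$ ($m\ge1$) in $c_{00}$ with rational coordinates, such that $\sigma(f_1,\dots,f_m)>2^{1/\|f_m\|_0}\max\operatorname{supp}f_m$. Fix also a sequence $(z_k)$ dense in the unit sphere of $C[0,1]$, let $(u_k)$ be the unit vectors of $c_{00}$ with the norm $\|\sum_ka_ku_k\|_u=\sup_{F}\|\sum_{k\in F}a_kz_k\|$ ($F$ finite), and let $u_k^*$ be their biorthogonals in the dual of the completion. **The norming set.** $W$ is the smallest subset of $c_{00}$ such that: 1. $\pm e_n\in W$ for all $n$; $-f\in W$ and $Ef\in W$ for every $f\in W$ and every interval $E$; and $W$ is closed under rational convex combinations. 2. For $n\ge1$, $\frac1{2^n}\sum_{q=1}^d\alpha_q\in W$ for every $\mathcal S_n$-admissible very fast growing sequence $(\alpha_q)_{q=1}^d$ of $\alpha$-averages. If $f$ is of this form and $E$ is an interval, $\pm Ef$ is called of type I$_\alpha$ with weight $n$. 3. The same holds with $\beta$-averages in place of $\alpha$-averages. 4. $f=\frac12\sum_{q\in F}(f_q+g_q)\in W$ for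 every special sequence $(f_q,g_q)_{q=1}^d$ and every $\emptyset\neq F\subset\{1,\dots,d\}$ with $2\,\#F\le\min\operatorname{supp}f_{\min F}$; for an interval $E$, $\pm Ef$ is called of type II$_+$. 5. $f=\frac12\sum_{q\in F}\lambda_q(f_q-g_q)\in W$ for the same data and rationals $\lambda_q$ with $\|\sum_{q\in F}\lambda_qu_q^*\|_u\le1$; for an interval $E$, $\pm Ef$ is called of type II$_-$. Functionals of type II$_\pm$ are said to be of type II. In 4 and 5 the functional $h=\pm Ef$ (in this representation) has the set of weights $\widehat w(h)=\{w_q:q\in F,\ \operatorname{ran}(f_q+g_q)\cap E\ne\emptyset\}$, where $w_q$ is the weight of $f_q$ in the special sequence. Here a special sequence is a sequence of pairs of functionals of type I$_\alpha$ with $f_1<g_1<f_2<\dots<f_d<g_d$, where $f_q$ and $g_q$ have the same weight $w_q$, $w_1\in L_1$, and $w_q=\sigma(f_1,g_1,\dots,f_{q-1},g_{q-1})$ for $1<q\le d$. An $\alpha$-average of size $n$ is an element of $W$ of the form $\frac1n\sum_{j=1}^df_j$ with $d\le n$ and $f_1<\dots<f_d$ in $W$; a $\beta$-average of size $n$ is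 an element of $W$ of the form $\frac1n\sum_{j=1}^df_j$ with $d\le n$ and $f_1,\dots,f_d\in W$ of type II with pairwise disjoint sets of weights. A sequence $f_1<f_2<\cdots$ of averages with sizes $s(f_j)$ is very fast growing if $s(f_j)>2^{\max\operatorname{supp}f_{j-1}}$ and $s(f_j)>s(f_{j-1})$ for $j>1$. A special branch is an infinite sequence $(f_q,g_q)_{q=1}^\infty$ all of whose initial segments are special sequences. Let $\mathfrak X$ be the completion of $c_{00}$ under $\|x\|=\sup\{f(x):f\in W\}$. A block sequence is a sequence $x_1<x_2<\cdots$ in $c_{00}$. **Indices.** The $\beta$-index of a block sequence $(x_k)$ is zero if, for every $n$, every (infinite) very fast growing sequence $(\beta_q)_q$ of $\beta$-averages in $W$, all nonempty finite sets $F_1<F_2<\cdots$ of naturals such that each $(\beta_q)_{q\in F_k}$ is $\mathcal S_n$-admissible, and every subsequence $(x_{n_k})_k$, one has $\lim_k\sum_{q\in F_k}|\beta_q(x_{n_k})|=0$. The branch index of $(x_k)$ is zero if for every special branch $(f_q,g_q)_q$ and every $\varepsilon>0$ there are $k_0,q_0$ such that $|(f_q\pm g_q)(x_k)|<\varepsilon$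 (for both signs) for all $k\ge k_0$, $q\ge q_0$. **Separation.** Let $x_1<x_2<x_3$ and let $f=\pm E\big(\frac12\sum_{q\in F}(f_q+g_q)\big)$ or $f=\pm E\big(\frac12\sum_{q\in F}\lambda_q(f_q-g_q)\big)$ be of type II, with $\operatorname{supp}f\cap\operatorname{ran}x_i\neq\emptyset$ for $i=1,2,3$. Let $q_0=\min\{q\in F:\operatorname{ran}(f_q+g_q)\cap\operatorname{ran}x_2\neq\emptyset\}$. If $\operatorname{ran}(f_{q_0}+g_{q_0})\cap\operatorname{ran}x_3=\emptyset$ (for some such representation of $f$), then $f$ separates $x_1,x_2,x_3$. **Proposition.** Let $(x_k)_k$ be a bounded block sequence in $\mathfrak X$ whose $\beta$-index and branch index are zero. Then for every $\varepsilon>0$ there is an infinite set $M\subset\mathbb N$ such that for all $k_1<k_2<k_3$ in $M$ and every functional $f\in W$ of type II that separates $x_{k_1},x_{k_2},x_{k_3}$, one has $|f(x_{k_i})|<\varepsilon$ for some $i\in\{1,2,3\}$. -/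

import Mathlib

open Filter Topology
open scoped NNReal

namespace SpreadHI

/-! ### Finitely supported vectors -/

/-- The space `c₀₀(ℕ)`, where `ℕ = {1, 2, …}`. -/
abbrev C00 : Type := ℕ+ →₀ ℝ

/-- The action `f(x) = ∑ᵢ f(i) x(i)` of a functional `f ∈ c₀₀` on a vector `x ∈ c₀₀`. -/
noncomputable def act (f x : C00) : ℝ := ∑ i ∈ f.support, f i * x i

/-- `min supp f`, for `f ≠ 0` (the value at `0` is never used). -/
noncomputable def minSupp (f : C00) : ℕ+ :=
  if h : f.support.Nonempty then f.support.min' h else 1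

/-- `max supp f`, for `f ≠ 0` (the value at `0` is never used). -/
noncomputable def maxSupp (f : C00) : ℕ+ :=
  if h : f.support.Nonempty then f.support.max' h else 1

/-- `ran f`: the smallest interval of `ℕ` that contains `supp f`. -/
def ran (f : C00) : Set ℕ+ :=
  {i | ∃ a ∈ f.support, ∃ b ∈ f.support, a ≤ i ∧ i ≤ b}

/-- The restriction `E f` of `f` to the interval `E = {a, …, b}` (empty if `b < a`).
On finitely supported vectors an unbounded interval acts as a bounded one. -/
noncomputable def restr (a b : ℕ+) (f : C00) : C00 := f.filter fun i => a ≤ i ∧ i ≤ b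

/-- All elements of `supp f` lie before all elements of `supp g`. -/
def Precedes (f g : C00) : Prop := ∀ i ∈ f.support, ∀ j ∈ g.support, i < j

/-- `f₁ < f₂ < ⋯`: a finite or infinite sequence of nonzero successive vectors. -/
def Successive {ι : Type} [LT ι] (f : ι → C00) : Prop :=
  (∀ i, f i ≠ 0) ∧ ∀ i j, i < j → Precedes (f i) (f j)

/-- The supremum norm `‖f‖₀` on `c₀₀`. -/
noncomputable def supNorm (f : C00) : ℝ := ((f.support.sup fun i => ‖f i‖₊ : ℝ≥0) : ℝ)

/-! ### Schreier families -/

/-- The Schreier families `𝒮ₙ`. -/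
def schreier : ℕ → Set (Finset ℕ+)
  | 0 => {F | ∃ m, F = {m}}
  | 1 => {F | ∀ m ∈ F, F.card ≤ (m : ℕ)}
  | n + 2 => {F | ∃ (k : ℕ) (H : Fin k → Finset ℕ+),
      (∀ j, (H j).Nonempty ∧ H j ∈ schreier (n + 1)) ∧
      (∀ i j, i < j → ∀ a ∈ H i, ∀ b ∈ H j, a < b) ∧
      (∀ j, ∀ a ∈ H j, k ≤ (a : ℕ)) ∧
      F = Finset.univ.biUnion H}

/-- `(f q)_{q ∈ F}` is `𝒮ₙ`-admissible: `{min supp f q : q ∈ F} ∈ 𝒮ₙ`. -/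
def Admissible {ι : Type} (n : ℕ) (F : Finset ι) (f : ι → C00) : Prop :=
  F.image (fun q => minSupp (f q)) ∈ schreier n

/-- The sequence `f` of averages, of sizes `s`, is very fast growing:
`f₁ < f₂ < ⋯`, `s j > 2 ^ max supp f (j - 1)` and `s j > s (j - 1)`. -/
def VeryFastGrowing {ι : Type} [LT ι] (s : ι → ℕ) (f : ι → C00) : Prop :=
  Successive f ∧ ∀ i j, i < j → 2 ^ (maxSupp (f i) : ℕ) < s j ∧ s i < s j

/-! ### Pełczyński's unconditional basis and the coding function -/

/-- The norm `‖∑ aₖ uₖ‖ᵤ = sup_F ‖∑_{k ∈ F} aₖ zₖ‖` on `c₀₀`; only the `F ⊆ supp a` matter. -/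
noncomputable def uNorm (z : ℕ → C(Set.Icc (0 : ℝ) 1, ℝ)) (a : ℕ →₀ ℝ) : ℝ :=
  ((a.support.powerset.sup fun F => ‖∑ k ∈ F, a k • z k‖₊ : ℝ≥0) : ℝ)

/-- `‖∑_{q ∈ F} λ_q u_q^*‖ᵤ ≤ 1`, for the norm of the dual of the completion of `(c₀₀, ‖·‖ᵤ)`. -/
def DualNormLeOne (z : ℕ → C(Set.Icc (0 : ℝ) 1, ℝ)) (F : Finset ℕ) (lam : ℕ → ℚ) : Prop :=
  ∀ a : ℕ →₀ ℝ, |∑ q ∈ F, (lam q : ℝ) * a q| ≤ uNorm z a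

/-- The set `𝒬` of nonempty finite sequences `f₁ < ⋯ < f_m` in `c₀₀` of (nonzero) vectors with
rational coordinates. -/
def RatSeqs : Set (List C00) :=
  {l | l ≠ [] ∧ (∀ f ∈ l, f ≠ 0 ∧ ∀ i, ∃ r : ℚ, f i = (r : ℝ)) ∧ l.Pairwise Precedes}

/-- The choices on which the construction depends: the lacunary set `L₀ = {ℓ₁ < ℓ₂ < ⋯}` (here
enumerated from `0`), its decomposition into infinite sets `L₁, L₂, L₃`, the coding function
`σ : 𝒬 → L₂` (whose values off `𝒬` play no role), and a dense sequence `z` in the unit sphere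
of `C[0,1]`. -/
structure Choices where
  ell : ℕ → ℕ
  nine_lt : 9 < ell 0
  lacunary : ∀ k, 2 ^ (2 * ell k) < ell (k + 1)
  sum_lt : ∑' k, (1 : ℝ) / 2 ^ ell k < 1 / 1000
  L₁ : Set ℕ
  L₂ : Set ℕ
  L₃ : Set ℕ
  infinite₁ : L₁.Infinite
  infinite₂ : L₂.Infinite
  infinite₃ : L₃.Infinite
  disjoint₁₂ : Disjoint L₁ L₂
  disjoint₁₃ : Disjoint L₁ L₃
  disjoint₂₃ : Disjoint L₂ L₃
  union_eq : L₁ ∪ L₂ ∪ L₃ = Set.range ell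
  coding : List C00 → ℕ
  coding_mapsTo : Set.MapsTo coding RatSeqs L₂
  coding_injOn : Set.InjOn coding RatSeqs
  coding_growth : ∀ (l : List C00) (hl : l ≠ []), l ∈ RatSeqs →
    (2 : ℝ) ^ (1 / supNorm (l.getLast hl)) * ((maxSupp (l.getLast hl) : ℕ) : ℝ) < coding l
  z : ℕ → C(Set.Icc (0 : ℝ) 1, ℝ)
  z_norm : ∀ k, ‖z k‖ = 1
  z_dense : Metric.sphere (0 : C(Set.Icc (0 : ℝ) 1, ℝ)) 1 ⊆ closure (Set.range z)

/-! ### The notions that enter the definition of the norming set, relative to a set `G` -/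

/-- `α` is an `α`-average in `G` of size `n`. -/
def IsAlphaAverage (G : Set C00) (α : C00) (n : ℕ) : Prop :=
  α ∈ G ∧ 1 ≤ n ∧ ∃ (d : ℕ) (f : Fin d → C00), d ≤ n ∧ (∀ j, f j ∈ G) ∧ Successive f ∧
    α = (1 / n : ℝ) • ∑ j, f j

/-- The results of the `(1/2ⁿ, 𝒮ₙ, α)` operation in `G`. -/
def alphaOp (G : Set C00) (n : ℕ) : Set C00 :=
  {f | ∃ (d : ℕ) (α : Fin d → C00) (s : Fin d → ℕ), (∀ q, IsAlphaAverage G (α q) (s q)) ∧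
    VeryFastGrowing s α ∧ Admissible n Finset.univ α ∧ f = (1 / 2 ^ n : ℝ) • ∑ q, α q}

/-- `g` is a functional of type I_α of weight `n`, i.e. `g = ± E f` with `f` as in `alphaOp`. -/
def IsTypeIAlpha (G : Set C00) (g : C00) (n : ℕ) : Prop :=
  1 ≤ n ∧ ∃ f ∈ alphaOp G n, ∃ a b : ℕ+, g = restr a b f ∨ g = -restr a b f

/-- The pairs `(f q, g q)`, `q < d`, of weights `w q`, form a special sequence of length `d`. -/
structure IsSpecial (P : Choices) (G : Set C00) (f g : ℕ → C00) (w : ℕ → ℕ) (d : ℕ) : Prop where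
  pos : 1 ≤ d
  typeF : ∀ q < d, IsTypeIAlpha G (f q) (w q)
  typeG : ∀ q < d, IsTypeIAlpha G (g q) (w q)
  ne_zero : ∀ q < d, f q ≠ 0 ∧ g q ≠ 0
  precFG : ∀ q < d, Precedes (f q) (g q)
  precGF : ∀ q, q + 1 < d → Precedes (g q) (f (q + 1))
  weight_first : w 0 ∈ P.L₁
  weight_next : ∀ q, 0 < q → q < d →
    P.coding ((List.range q).flatMap fun i => [f i, g i]) = w q

/-- A finite sequence of pairs `(f q, g q)`, `q < d`, with weights `w q`, and a set `F` of
indices. -/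
structure SpecialData where
  f : ℕ → C00
  g : ℕ → C00
  w : ℕ → ℕ
  d : ℕ
  F : Finset ℕ

/-- The sequence is special, `∅ ≠ F ⊆ {q : q < d}`, and `2 #F ≤ min supp f_{min F}`. -/
def SpecialData.Valid (P : Choices) (G : Set C00) (D : SpecialData) : Prop :=
  IsSpecial P G D.f D.g D.w D.d ∧ (∀ q ∈ D.F, q < D.d) ∧
    ∃ h : D.F.Nonempty, 2 * D.F.card ≤ (minSupp (D.f (D.F.min' h)) : ℕ)

/-- `½ ∑_{q ∈ F} (f_q + g_q)`. -/
noncomputable def SpecialData.plus (D : SpecialData) : C00 :=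
  (1 / 2 : ℝ) • ∑ q ∈ D.F, (D.f q + D.g q)

/-- `½ ∑_{q ∈ F} λ_q (f_q - g_q)`. -/
noncomputable def SpecialData.minus (D : SpecialData) (lam : ℕ → ℚ) : C00 :=
  (1 / 2 : ℝ) • ∑ q ∈ D.F, (lam q : ℝ) • (D.f q - D.g q)

/-- The set of weights `ŵ(h) = {w(f_q) : q ∈ F, ran (f_q ± g_q) ∩ E ≠ ∅}` with `E = {a, …, b}`;
as `f_q < g_q`, the vectors `f_q + g_q` and `f_q - g_q` have the same range. -/
def SpecialData.weights (D : SpecialData) (a b : ℕ+) : Set ℕ :=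
  {n | ∃ q ∈ D.F, (ran (D.f q + D.g q) ∩ Set.Icc a b).Nonempty ∧ n = D.w q}

/-- `h` is a functional of type II₊, represented by `D` and the interval `{a, …, b}`. -/
def IsTypeIIPlus (P : Choices) (G : Set C00) (D : SpecialData) (a b : ℕ+) (h : C00) : Prop :=
  D.Valid P G ∧ (h = restr a b D.plus ∨ h = -restr a b D.plus)

/-- `h` is a functional of type II₋, represented by `D` and the interval `{a, …, b}`. -/
def IsTypeIIMinus (P : Choices) (G : Set C00) (D : SpecialData) (a b : ℕ+) (h : C00) : Prop :=
  D.Valid P G ∧ ∃ lam : ℕ → ℚ, DualNormLeOne P.z D.F lam ∧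
    (h = restr a b (D.minus lam) ∨ h = -restr a b (D.minus lam))

/-- `h` is a functional of type II, represented by `D` and the interval `{a, …, b}`. -/
def IsTypeII (P : Choices) (G : Set C00) (D : SpecialData) (a b : ℕ+) (h : C00) : Prop :=
  IsTypeIIPlus P G D a b h ∨ IsTypeIIMinus P G D a b h

/-- `β` is a `β`-average in `G` of size `n`. -/
def IsBetaAverage (P : Choices) (G : Set C00) (β : C00) (n : ℕ) : Prop :=
  β ∈ G ∧ 1 ≤ n ∧ ∃ (d : ℕ) (f : Fin d → C00) (D : Fin d → SpecialData) (a b : Fin d → ℕ+),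
    d ≤ n ∧ (∀ j, f j ∈ G) ∧ (∀ j, IsTypeII P G (D j) (a j) (b j) (f j)) ∧
    (∀ i j, i ≠ j → Disjoint ((D i).weights (a i) (b i)) ((D j).weights (a j) (b j))) ∧
    β = (1 / n : ℝ) • ∑ j, f j

/-- The results of the `(1/2ⁿ, 𝒮ₙ, β)` operation in `G`. -/
def betaOp (P : Choices) (G : Set C00) (n : ℕ) : Set C00 :=
  {f | ∃ (d : ℕ) (β : Fin d → C00) (s : Fin d → ℕ), (∀ q, IsBetaAverage P G (β q) (s q)) ∧
    VeryFastGrowing s β ∧ Admissible n Finset.univ β ∧ f = (1 / 2 ^ n : ℝ) • ∑ q, β q}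

/-! ### The norming set -/

/-- The closure properties of the norming set. -/
structure IsNormingClosed (P : Choices) (G : Set C00) : Prop where
  basis : ∀ n, Finsupp.single n 1 ∈ G
  neg : ∀ f ∈ G, -f ∈ G
  interval : ∀ f ∈ G, ∀ a b, restr a b f ∈ G
  convex : ∀ (m : ℕ) (f : Fin m → C00) (c : Fin m → ℚ), (∀ j, f j ∈ G) → (∀ j, 0 ≤ c j) →
    ∑ j, c j = 1 → ∑ j, (c j : ℝ) • f j ∈ G
  alpha : ∀ n, 1 ≤ n → alphaOp G n ⊆ G
  beta : ∀ n, 1 ≤ n → betaOp P G n ⊆ G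
  plus : ∀ D : SpecialData, D.Valid P G → D.plus ∈ G
  minus : ∀ (D : SpecialData) (lam : ℕ → ℚ), D.Valid P G → DualNormLeOne P.z D.F lam →
    D.minus lam ∈ G

/-- The norming set `W`: the smallest set with the above closure properties. -/
def W (P : Choices) : Set C00 := ⋂₀ {G | IsNormingClosed P G}

/-! The set `W` itself has these closure properties. -/

theorem IsAlphaAverage.mono {G H : Set C00} (hGH : G ⊆ H) {α : C00} {n : ℕ}
    (h : IsAlphaAverage G α n) : IsAlphaAverage H α n := by
  obtain ⟨h1, h2, d, f, h3, h4, h5, h6⟩ := h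
  exact ⟨hGH h1, h2, d, f, h3, fun j => hGH (h4 j), h5, h6⟩

theorem alphaOp_mono {G H : Set C00} (hGH : G ⊆ H) (n : ℕ) : alphaOp G n ⊆ alphaOp H n := by
  rintro f ⟨d, α, s, h1, h2⟩
  exact ⟨d, α, s, fun q => (h1 q).mono hGH, h2⟩

theorem IsTypeIAlpha.mono {G H : Set C00} (hGH : G ⊆ H) {g : C00} {n : ℕ}
    (h : IsTypeIAlpha G g n) : IsTypeIAlpha H g n := by
  obtain ⟨h1, f, h2, h3⟩ := h
  exact ⟨h1, f, alphaOp_mono hGH n h2, h3⟩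

theorem SpecialData.Valid.mono {P : Choices} {G H : Set C00} (hGH : G ⊆ H) {D : SpecialData}
    (h : D.Valid P G) : D.Valid P H :=
  ⟨{ h.1 with
      typeF := fun q hq => (h.1.typeF q hq).mono hGH
      typeG := fun q hq => (h.1.typeG q hq).mono hGH }, h.2⟩

theorem IsTypeII.mono {P : Choices} {G H : Set C00} (hGH : G ⊆ H) {D : SpecialData} {a b : ℕ+}
    {h : C00} (hh : IsTypeII P G D a b h) : IsTypeII P H D a b h :=
  hh.imp (fun h => ⟨h.1.mono hGH, h.2⟩) (fun h => ⟨h.1.mono hGH, h.2⟩)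

theorem betaOp_mono {P : Choices} {G H : Set C00} (hGH : G ⊆ H) (n : ℕ) :
    betaOp P G n ⊆ betaOp P H n := by
  rintro f ⟨d, β, s, h1, h2⟩
  refine ⟨d, β, s, fun q => ?_, h2⟩
  obtain ⟨g1, g2, e, f, D, a, b, g3, g4, g5, g6⟩ := h1 q
  exact ⟨hGH g1, g2, e, f, D, a, b, g3, fun j => hGH (g4 j), fun j => (g5 j).mono hGH, g6⟩

theorem isNormingClosed_W (P : Choices) : IsNormingClosed P (W P) := by
  have sub : ∀ {G : Set C00}, IsNormingClosed P G → W P ⊆ G := fun hG => Set.sInter_subset_of_mem hG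
  refine ⟨?_, ?_, ?_, ?_, ?_, ?_, ?_, ?_⟩
  · exact fun n G hG => hG.basis n
  · exact fun f hf G hG => hG.neg f (hf G hG)
  · exact fun f hf a b G hG => hG.interval f (hf G hG) a b
  · exact fun m f c h1 h2 h3 G hG => hG.convex m f c (fun j => h1 j G hG) h2 h3
  · exact fun n hn f hf G hG => hG.alpha n hn (alphaOp_mono (sub hG) n hf)
  · exact fun n hn f hf G hG => hG.beta n hn (betaOp_mono (sub hG) n hf)
  · exact fun D hD G hG => hG.plus D (hD.mono (sub hG))
  · exact fun D lam hD hl G hG => hG.minus D lam (hD.mono (sub hG)) hl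

/-! Elements of `W` have rational coordinates in `[-1, 1]`; in particular the supremum below is over
a bounded set, and the sequences to which `σ` is applied above are in `𝒬`. -/

theorem restr_apply (a b : ℕ+) (f : C00) (i : ℕ+) :
    restr a b f i = f i ∨ restr a b f i = 0 := by
  unfold restr
  by_cases h : a ≤ i ∧ i ≤ b
  · exact Or.inl (Finsupp.filter_apply_pos _ _ h)
  · exact Or.inr (Finsupp.filter_apply_neg _ _ h)

/-- Rational coordinates in `[-1, 1]`. -/
def ratBall : Set C00 := {f | ∀ i, ∃ r : ℚ, f i = r ∧ |r| ≤ 1}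

theorem ratBall_neg {f : C00} (h : f ∈ ratBall) : -f ∈ ratBall := fun i => by
  obtain ⟨r, h1, h2⟩ := h i
  exact ⟨-r, by simp [h1], by simpa using h2⟩

theorem ratBall_restr {f : C00} (h : f ∈ ratBall) (a b : ℕ+) : restr a b f ∈ ratBall := fun i => by
  rcases restr_apply a b f i with h1 | h1
  · rw [h1]; exact h i
  · exact ⟨0, by simp [h1], by simp⟩

/-- A sum of vectors of `ratBall`, of which at most one is nonzero at each coordinate. -/
theorem ratBall_sum {ι : Type} (s : Finset ι) (f : ι → C00) (h : ∀ q ∈ s, f q ∈ ratBall)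
    (hd : ∀ p ∈ s, ∀ q ∈ s, p ≠ q → ∀ i, f p i = 0 ∨ f q i = 0) : ∑ q ∈ s, f q ∈ ratBall := by
  intro i
  rw [Finsupp.finsetSum_apply]
  by_cases hz : ∃ p ∈ s, f p i ≠ 0
  · obtain ⟨p, hp, hpi⟩ := hz
    rw [Finset.sum_eq_single p]
    · exact h p hp i
    · exact fun q hq hqp => (hd p hp q hq hqp.symm i).resolve_left hpi
    · exact fun hn => absurd hp hn
  · push Not at hz
    exact ⟨0, by rw [Finset.sum_eq_zero hz]; simp, by simp⟩

theorem ratBall_smul {f : C00} (h : f ∈ ratBall) (r : ℚ) (hr : |r| ≤ 1) :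
    (r : ℝ) • f ∈ ratBall := fun i => by
  obtain ⟨t, h1, h2⟩ := h i
  refine ⟨r * t, by simp [h1], ?_⟩
  rw [abs_mul]
  exact mul_le_one₀ hr (abs_nonneg _) h2

theorem Precedes.eq_zero {f g : C00} (h : Precedes f g) (i : ℕ+) : f i = 0 ∨ g i = 0 := by
  by_contra! hc
  exact lt_irrefl i (h i (Finsupp.mem_support_iff.2 hc.1) i (Finsupp.mem_support_iff.2 hc.2))

theorem ratBall_pow_smul {f : C00} (h : f ∈ ratBall) (n : ℕ) :
    (1 / 2 ^ n : ℝ) • f ∈ ratBall := by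
  have h1 : |(1 / 2 ^ n : ℚ)| ≤ 1 := by
    rw [abs_of_nonneg (by positivity), div_le_one (by positivity)]
    exact one_le_pow₀ (by norm_num)
  simpa using ratBall_smul h _ h1

theorem Successive.sum_mem {d : ℕ} {α : Fin d → C00} (hs : Successive α)
    (h : ∀ q, α q ∈ ratBall) : ∑ q, α q ∈ ratBall := by
  refine ratBall_sum _ _ (fun q _ => h q) fun p _ q _ hpq i => ?_
  rcases lt_or_gt_of_ne hpq with hl | hl
  · exact (hs.2 p q hl).eq_zero i
  · exact ((hs.2 q p hl).eq_zero i).symm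

theorem alphaOp_ratBall (n : ℕ) : alphaOp ratBall n ⊆ ratBall := by
  rintro f ⟨d, α, s, h1, h2, -, rfl⟩
  exact ratBall_pow_smul (h2.1.sum_mem fun q => (h1 q).1) n

theorem IsTypeIAlpha.mem_ratBall {g : C00} {n : ℕ} (h : IsTypeIAlpha ratBall g n) :
    g ∈ ratBall := by
  obtain ⟨-, f, h1, a, b, rfl | rfl⟩ := h
  · exact ratBall_restr (alphaOp_ratBall n h1) a b
  · exact ratBall_neg (ratBall_restr (alphaOp_ratBall n h1) a b)

theorem Precedes.trans' {f g h : C00} (h1 : Precedes f g) (h2 : Precedes g h) (hg : g ≠ 0) :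
    Precedes f h := fun i hi j hj => by
  obtain ⟨k, hk⟩ := Finsupp.support_nonempty_iff.2 hg
  exact (h1 i hi k hk).trans (h2 k hk j hj)

/-- In a special sequence `f₁ < g₁ < f₂ < g₂ < ⋯`. -/
theorem IsSpecial.prec {P : Choices} {G : Set C00} {f g : ℕ → C00} {w : ℕ → ℕ} {d : ℕ}
    (h : IsSpecial P G f g w d) {p q : ℕ} (hpq : p < q) (hq : q < d) :
    Precedes (g p) (f q) := by
  induction q, hpq using Nat.le_induction with
  | base => exact h.precGF p hq
  | succ q hpq ih =>
    exact ((ih (by omega)).trans' (h.precFG q (by omega)) (h.ne_zero q (by omega)).1).trans'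
      (h.precGF q hq) (h.ne_zero q (by omega)).2

theorem IsSpecial.eq_zero {P : Choices} {G : Set C00} {f g : ℕ → C00} {w : ℕ → ℕ} {d : ℕ}
    (h : IsSpecial P G f g w d) {p q : ℕ} (hpq : p < q) (hq : q < d) (i : ℕ+) :
    (f p i = 0 ∧ g p i = 0) ∨ (f q i = 0 ∧ g q i = 0) := by
  have h1 := h.prec hpq hq
  have h2 := (h.precFG p (by omega)).trans' h1 (h.ne_zero p (by omega)).2
  have h3 := h1.trans' (h.precFG q hq) (h.ne_zero q hq).1
  have h4 := h2.trans' (h.precFG q hq) (h.ne_zero q hq).1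
  have := h1.eq_zero i
  have := h2.eq_zero i
  have := h3.eq_zero i
  have := h4.eq_zero i
  tauto

theorem DualNormLeOne.abs_le {P : Choices} {F : Finset ℕ} {lam : ℕ → ℚ}
    (h : DualNormLeOne P.z F lam) {q : ℕ} (hq : q ∈ F) : |lam q| ≤ 1 := by
  have h1 := h (Finsupp.single q 1)
  rw [Finset.sum_eq_single q (fun p _ hp => by simp [hp.symm])
    (fun hn => absurd hq hn)] at h1
  have h2 : uNorm P.z (Finsupp.single q 1) ≤ 1 := by
    refine NNReal.coe_le_one.2 (Finset.sup_le fun F hF => ?_)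
    rw [Finsupp.support_single _ one_ne_zero, Finset.mem_powerset,
      Finset.subset_singleton_iff] at hF
    rcases hF with rfl | rfl
    · simp
    · rw [← NNReal.coe_le_coe]
      simp [P.z_norm q]
  have h3 : |(lam q : ℝ)| ≤ 1 := by simpa using h1.trans h2
  exact_mod_cast h3

theorem SpecialData.Valid.sum_mem {P : Choices} {D : SpecialData} (h : D.Valid P ratBall)
    (c e : ℕ → ℚ) (hc : ∀ q ∈ D.F, |c q| ≤ 1) (he : ∀ q ∈ D.F, |e q| ≤ 1) :
    (1 / 2 : ℝ) • ∑ q ∈ D.F, ((c q : ℝ) • D.f q + (e q : ℝ) • D.g q) ∈ ratBall := by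
  have hs := h.1
  have h2 : ∑ q ∈ D.F, ((c q : ℝ) • D.f q + (e q : ℝ) • D.g q) ∈ ratBall := by
    refine ratBall_sum _ _ (fun q hq i => ?_) fun p hp q hq hpq i => ?_
    · have hqd := h.2.1 q hq
      rcases (hs.precFG q hqd).eq_zero i with h0 | h0
      · simpa [h0] using ratBall_smul (hs.typeG q hqd).mem_ratBall _ (he q hq) i
      · simpa [h0] using ratBall_smul (hs.typeF q hqd).mem_ratBall _ (hc q hq) i
    · rcases lt_or_gt_of_ne hpq with hl | hl
      · rcases hs.eq_zero hl (h.2.1 q hq) i with h0 | h0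
        · exact Or.inl (by simp [h0.1, h0.2])
        · exact Or.inr (by simp [h0.1, h0.2])
      · rcases hs.eq_zero hl (h.2.1 p hp) i with h0 | h0
        · exact Or.inr (by simp [h0.1, h0.2])
        · exact Or.inl (by simp [h0.1, h0.2])
  simpa using ratBall_pow_smul h2 1

theorem isNormingClosed_ratBall (P : Choices) : IsNormingClosed P ratBall := by
  refine ⟨?_, fun f => ratBall_neg, fun f => ratBall_restr, ?_, fun n _ => alphaOp_ratBall n,
    ?_, ?_, ?_⟩
  · intro n i
    by_cases h : n = i
    · exact ⟨1, by simp [h], by simp⟩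
    · exact ⟨0, by simp [h], by simp⟩
  · intro m f c hf hc h1 i
    choose r hr hr1 using fun j => hf j i
    refine ⟨∑ j, c j * r j, by simp [Finsupp.finsetSum_apply, hr], ?_⟩
    calc |∑ j, c j * r j| ≤ ∑ j, |c j * r j| := Finset.abs_sum_le_sum_abs _ _
      _ ≤ ∑ j, c j := Finset.sum_le_sum fun j _ => by
          rw [abs_mul, abs_of_nonneg (hc j)]
          exact mul_le_of_le_one_right (hc j) (hr1 j)
      _ = 1 := h1
  · rintro n - f ⟨d, β, s, h1, h2, -, rfl⟩
    exact ratBall_pow_smul (h2.1.sum_mem fun q => (h1 q).1) n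
  · intro D hD
    simpa [SpecialData.plus] using hD.sum_mem (fun _ => 1) (fun _ => 1) (by simp) (by simp)
  · intro D lam hD hl
    have := hD.sum_mem lam (fun q => -lam q) (fun q hq => hl.abs_le hq)
      (fun q hq => by simpa using hl.abs_le hq)
    simpa [SpecialData.minus, smul_sub, sub_eq_add_neg] using this

theorem exists_rat_of_mem_W {P : Choices} {f : C00} (hf : f ∈ W P) (i : ℕ+) :
    ∃ r : ℚ, f i = r ∧ |r| ≤ 1 :=
  hf ratBall (isNormingClosed_ratBall P) i

theorem bddAbove_act (P : Choices) (x : C00) : BddAbove {t | ∃ f ∈ W P, t = act f x} := by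
  refine ⟨∑ i ∈ x.support, |x i|, ?_⟩
  rintro t ⟨f, hf, rfl⟩
  have h1 : act f x = ∑ i ∈ x.support, f i * x i := by
    unfold act
    rw [← Finset.sum_subset (Finset.inter_subset_left : f.support ∩ x.support ⊆ f.support),
      ← Finset.sum_subset (Finset.inter_subset_right : f.support ∩ x.support ⊆ x.support)]
    · intro i hi hn
      simp_all
    · intro i hi hn
      simp_all
  rw [h1]
  refine Finset.sum_le_sum fun i _ => ?_
  obtain ⟨r, hr, hr1⟩ := exists_rat_of_mem_W hf i
  have h2 : |f i| ≤ 1 := by rw [hr]; exact_mod_cast hr1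
  calc f i * x i ≤ |f i * x i| := le_abs_self _
    _ = |f i| * |x i| := abs_mul _ _
    _ ≤ |x i| := mul_le_of_le_one_left (abs_nonneg _) h2

/-- The norm `‖x‖ = sup {f(x) : f ∈ W}` of the space (the completion of `c₀₀` in this norm);
the supremum is over a bounded set, see `bddAbove_act`. -/
noncomputable def normX (P : Choices) (x : C00) : ℝ := sSup {t | ∃ f ∈ W P, t = act f x}

/-! ### Block sequences, indices, separation -/

/-- A bounded block sequence. -/
def IsBoundedBlock (P : Choices) (x : ℕ → C00) : Prop :=
  Successive x ∧ ∃ C : ℝ, ∀ k, normX P (x k) ≤ C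

/-- The `β`-index of `x` is zero. -/
def BetaIndexZero (P : Choices) (x : ℕ → C00) : Prop :=
  ∀ (n : ℕ) (β : ℕ → C00) (s : ℕ → ℕ), (∀ q, IsBetaAverage P (W P) (β q) (s q)) →
    VeryFastGrowing s β →
    ∀ F : ℕ → Finset ℕ, (∀ k, (F k).Nonempty) → (∀ k l, k < l → ∀ i ∈ F k, ∀ j ∈ F l, i < j) →
    (∀ k, Admissible n (F k) β) →
    ∀ φ : ℕ → ℕ, StrictMono φ →
      Tendsto (fun k => ∑ q ∈ F k, |act (β q) (x (φ k))|) atTop (𝓝 0)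

/-- The pairs `(f q, g q)`, `q ∈ ℕ`, form a special branch. -/
def IsBranch (P : Choices) (f g : ℕ → C00) : Prop :=
  ∃ w : ℕ → ℕ, ∀ d, 1 ≤ d → IsSpecial P (W P) f g w d

/-- The branch index of `x` is zero. -/
def BranchIndexZero (P : Choices) (x : ℕ → C00) : Prop :=
  ∀ f g : ℕ → C00, IsBranch P f g →
    ∀ ε : ℝ, 0 < ε → ∃ k₀ q₀ : ℕ, ∀ k ≥ k₀, ∀ q ≥ q₀,
      |act (f q + g q) (x k)| < ε ∧ |act (f q - g q) (x k)| < ε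

/-- The functional `f` of type II separates `x₁ < x₂ < x₃`. -/
def Separates (P : Choices) (f x₁ x₂ x₃ : C00) : Prop :=
  ∃ (D : SpecialData) (a b : ℕ+), IsTypeII P (W P) D a b f ∧
    ((f.support : Set ℕ+) ∩ ran x₁).Nonempty ∧ ((f.support : Set ℕ+) ∩ ran x₂).Nonempty ∧
    ((f.support : Set ℕ+) ∩ ran x₃).Nonempty ∧
    ∃ q₀, IsLeast {q | q ∈ D.F ∧ (ran (D.f q + D.g q) ∩ ran x₂).Nonempty} q₀ ∧
      ran (D.f q₀ + D.g q₀) ∩ ran x₃ = ∅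

end SpreadHI

/-!
The proof is by contradiction, with a nonprincipal ultrafilter on `ℕ` in place of Ramsey's theorem.
If no set `M` exists, then there is `k₀` such that for generic `k` and then generic `m` some
`f_{k,m}` of type II separates `x_{k₀}, x_k, x_m` and has values at least `ε` at all three. Let
`q₀(k,m)` be the index of the first pair of its special sequence that meets `ran x_k`.

* Since `f_{k,m}` acts on `x_{k₀}`, the condition `2 #F ≤ min supp f_{min F}` bounds the number of
  its pairs by a constant, so a single pair `f_q ± g_q` with `q ≥ q₀(k,m)` is large on `x_k`
  (`IsBad.exists_pair`).
* All pairs that meet `ran x_m` come after `q₀(k,m)`. As `σ` is one-to-one, either the weights of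
  `f_{k,m}` and `f_{l,m}` on `x_m` are disjoint, or both special sequences agree up to both indices
  `q₀` (`IsBad.disjoint_or_agree`). Generic disjointness yields `β`-averages that are large on the
  `x_m`, against the hypothesis on the `β`-index (`IsBadFamily.genericAgree`).
* The weight at `q₀(k,m)` is bounded in `m`, because functionals of type I of large weight are small
  at the fixed vector `x_k` (`IsBad.weight_lt`). Since weights determine all earlier pairs, for
  generic `m` the index `q₀(k,m) = q(k)` and the pairs before it do not depend on `m`.
* If `q(k) → ∞`, these initial segments converge to a special branch which is large on the `x_k`
  beyond any index, against the hypothesis on the branch index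
  (`IsBadFamily.false_of_unbounded`).
* If `q(k)` is constant, one pair, depending on `m` only, is large on all generic `x_k`, and its
  ultralimit in `m` is a pair of points of the pointwise closure of `W` that do not tend to zero
  along `(x_k)` (`IsBadFamily.false_of_const`). This contradicts the fact that bounded block
  sequences are weakly null (`tendsto_pair_of_mem_clW`), which needs no hypothesis on the indices.

For the last fact, let `θ` be the supremum of `limsup |h(x_k)|` over `h` in the pointwise closure of
`W`. Apart from convex combinations, an element of `W` is `2⁻ⁿ` times, with `n ≥ 1`, a sum of
successive elements of `W` whose minima form a set in `𝒮ₙ` (or a signed unit vector); for type II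
this holds with `n = 1`. By compactness of `𝒮ₙ` only one of the pieces survives at infinity in a
pointwise limit, so that limits of such elements have upper limit at most `θ / 2` along `(x_k)`.
A point of the closed convex hull is the barycentre of a probability measure, and Fatou's lemma
carries the bound over to it. Hence `θ ≤ θ / 2`, and `θ = 0`.
-/

open Filter Topology
open scoped NNReal

namespace SpreadHI

/-! ### Ultrafilter combinatorics -/

/-- Ramsey's theorem for triples, in ultrafilter form: a property of triples that holds
`U`-iteratively holds for all increasing triples of some infinite set. -/
theorem exists_infinite_of_eventually_triple (R : ℕ → ℕ → ℕ → Prop)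
    (h : ∀ᶠ a in (hyperfilter ℕ : Filter ℕ), ∀ᶠ b in (hyperfilter ℕ : Filter ℕ),
      ∀ᶠ c in (hyperfilter ℕ : Filter ℕ), R a b c) :
    ∃ M : Set ℕ, M.Infinite ∧ ∀ a ∈ M, ∀ b ∈ M, ∀ c ∈ M, a < b → b < c → R a b c := by
  -- A finite set is good if its singletons, pairs and triples all have generic extensions in `R`.
  let Good : Finset ℕ → Prop := fun S =>
    (∀ a ∈ S, ∀ᶠ b in (hyperfilter ℕ : Filter ℕ), ∀ᶠ c in (hyperfilter ℕ : Filter ℕ), R a b c) ∧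
    (∀ a ∈ S, ∀ b ∈ S, a < b → ∀ᶠ c in (hyperfilter ℕ : Filter ℕ), R a b c) ∧
    (∀ a ∈ S, ∀ b ∈ S, ∀ c ∈ S, a < b → b < c → R a b c)
  have hgt : ∀ n, ∀ᶠ y in (hyperfilter ℕ : Filter ℕ), n < y := fun n =>
    Nat.hyperfilter_le_atTop (eventually_gt_atTop n)
  have hstep : ∀ S, Good S → ∃ y, (∀ a ∈ S, a < y) ∧ Good (insert y S) := by
    rintro S ⟨h1, h2, h3⟩
    have e1 : ∀ᶠ y in (hyperfilter ℕ : Filter ℕ), ∀ a ∈ S, a < y :=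
      (S.eventually_all).2 fun a _ => hgt a
    have e2 : ∀ᶠ y in (hyperfilter ℕ : Filter ℕ), ∀ a ∈ S,
        ∀ᶠ c in (hyperfilter ℕ : Filter ℕ), R a y c := (S.eventually_all).2 h1
    have e3 : ∀ᶠ y in (hyperfilter ℕ : Filter ℕ), ∀ a ∈ S, ∀ b ∈ S, a < b → R a b y :=
      (S.eventually_all).2 fun a ha => (S.eventually_all).2 fun b hb => by
        by_cases hab : a < b
        · filter_upwards [h2 a ha b hb hab] with y hy _ using hy
        · exact Eventually.of_forall fun y hy => absurd hy hab
    obtain ⟨y, y0, y1, y2, y3⟩ := (h.and (e1.and (e2.and e3))).exists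
    refine ⟨y, y1, ?_, ?_, ?_⟩
    · intro a ha
      rcases Finset.mem_insert.1 ha with rfl | ha
      · exact y0
      · exact h1 a ha
    · intro a ha b hb hab
      rcases Finset.mem_insert.1 hb with rfl | hb'
      · rcases Finset.mem_insert.1 ha with rfl | ha'
        · exact absurd hab (lt_irrefl _)
        · exact y2 a ha'
      · rcases Finset.mem_insert.1 ha with rfl | ha'
        · exact absurd hab (y1 b hb').le.not_gt
        · exact h2 a ha' b hb' hab
    · intro a ha b hb c hc hab hbc
      have hlt : ∀ p ∈ insert y S, ∀ q ∈ insert y S, p < q → p ∈ S := by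
        intro p hp q hq hpq
        rcases Finset.mem_insert.1 hp with rfl | hp'
        · rcases Finset.mem_insert.1 hq with rfl | hq'
          · exact absurd hpq (lt_irrefl _)
          · exact absurd hpq (y1 q hq').le.not_gt
        · exact hp'
      have ha' := hlt a ha b hb hab
      have hb' := hlt b hb c hc hbc
      rcases Finset.mem_insert.1 hc with rfl | hc'
      · exact y3 a ha' b hb' hab
      · exact h3 a ha' b hb' c hc' hab hbc
  choose y hy1 hy2 using hstep
  let T : ℕ → {S // Good S} := fun n => Nat.rec ⟨∅, by simp [Good]⟩
    (fun _ S => ⟨insert (y S.1 S.2) S.1, hy2 S.1 S.2⟩) n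
  let z : ℕ → ℕ := fun n => y (T n).1 (T n).2
  have hT : ∀ n, (T (n + 1)).1 = insert (z n) (T n).1 := fun n => rfl
  have hzT : ∀ m n, m < n → z m ∈ (T n).1 := by
    intro m n hmn
    induction n, hmn using Nat.le_induction with
    | base => rw [hT]; exact Finset.mem_insert_self _ _
    | succ n _ ih => rw [hT]; exact Finset.mem_insert_of_mem ih
  have hz : StrictMono z := fun m n hmn => hy1 _ (T n).2 _ (hzT m n hmn)
  refine ⟨Set.range z, Set.infinite_range_of_injective hz.injective, ?_⟩
  rintro _ ⟨a, rfl⟩ _ ⟨b, rfl⟩ _ ⟨c, rfl⟩ hab hbc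
  have hab' := hz.lt_iff_lt.1 hab
  have hbc' := hz.lt_iff_lt.1 hbc
  exact (T (c + 1)).2.2.2 _ (hzT a (c + 1) (by omega)) _ (hzT b (c + 1) (by omega))
    _ (hzT c (c + 1) (by omega)) hab hbc

/-- The Schreier families are compact: an ultralimit of elements of `𝒮ₙ` is finite. -/
theorem finite_setOf_eventually_mem_of_schreier {ι : Type} (V : Ultrafilter ι) (n : ℕ) :
    ∀ S : ι → Finset ℕ+, (∀ᶠ t in (V : Filter ι), S t ∈ schreier n) →
      {i | ∀ᶠ t in (V : Filter ι), i ∈ S t}.Finite := by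
  induction n using Nat.strong_induction_on with
  | _ n ih =>
  match n, ih with
  | 0, _ =>
    intro S hS
    refine Set.Subsingleton.finite fun i hi j hj => ?_
    obtain ⟨t, ⟨m, hm⟩, hi, hj⟩ := (hS.and (hi.and hj)).exists
    rw [hm, Finset.mem_singleton] at hi hj
    rw [hi, hj]
  | 1, _ =>
    intro S hS
    by_contra hinf
    have hinf : {i | ∀ᶠ t in (V : Filter ι), i ∈ S t}.Infinite := hinf
    obtain ⟨b, hb⟩ := hinf.nonempty
    obtain ⟨B, hB, hBc⟩ := hinf.exists_subset_card_eq (b + 1)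
    have : ∀ᶠ t in (V : Filter ι), ∀ i ∈ B, i ∈ S t := (B.eventually_all).2 fun i hi => hB hi
    obtain ⟨t, ht, h1, h2⟩ := (hS.and (this.and hb)).exists
    have h3 := ht b h2
    have h4 := Finset.card_le_card (show B ⊆ S t from h1)
    omega
  | n + 2, ih =>
    intro S hS
    rcases Set.eq_empty_or_nonempty {i | ∀ᶠ t in (V : Filter ι), i ∈ S t} with h0 | ⟨b, hb⟩
    · rw [h0]; exact Set.finite_empty
    -- The number of pieces of `S t` is at most `b`, so it may be assumed constant.
    have h1 : ∀ᶠ t in (V : Filter ι), ∃ k ∈ Finset.range (b + 1), ∃ H : Fin k → Finset ℕ+,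
        (∀ j, H j ∈ schreier (n + 1)) ∧ S t = Finset.univ.biUnion H := by
      filter_upwards [hS, hb] with t ⟨k, H, hH1, _, hH3, hH4⟩ hbt
      refine ⟨k, ?_, H, fun j => (hH1 j).2, hH4⟩
      rw [hH4] at hbt
      obtain ⟨j, -, hj⟩ := Finset.mem_biUnion.1 hbt
      have := hH3 j b hj
      exact Finset.mem_range.2 (by omega)
    have h2 : ∃ k ∈ Finset.range (b + 1), ∀ᶠ t in (V : Filter ι), ∃ H : Fin k → Finset ℕ+,
        (∀ j, H j ∈ schreier (n + 1)) ∧ S t = Finset.univ.biUnion H :=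
      (Ultrafilter.eventually_exists_mem_iff (Finset.finite_toSet _)).1 h1
    obtain ⟨k, -, hk⟩ := h2
    have : ∃ H : ι → Fin k → Finset ℕ+, ∀ᶠ t in (V : Filter ι),
        (∀ j, H t j ∈ schreier (n + 1)) ∧ S t = Finset.univ.biUnion (H t) := by
      classical
      refine ⟨fun t => if h : ∃ H : Fin k → Finset ℕ+,
        (∀ j, H j ∈ schreier (n + 1)) ∧ S t = Finset.univ.biUnion H then h.choose
          else fun _ => ∅, ?_⟩
      filter_upwards [hk] with t ht
      rw [dif_pos ht]
      exact ht.choose_spec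
    obtain ⟨H, hH⟩ := this
    refine (Set.finite_iUnion fun j : Fin k => ih (n + 1) (by omega) (fun t => H t j)
      (hH.mono fun t ht => ht.1 j)).subset fun i hi => ?_
    have h3 : ∀ᶠ t in (V : Filter ι), ∃ j : Fin k, i ∈ H t j := by
      filter_upwards [hH, hi] with t ht hit
      rw [ht.2] at hit
      simpa using hit
    rw [Set.mem_iUnion]
    exact Ultrafilter.eventually_exists_iff.1 h3

/-! ### Barycentres -/

open MeasureTheory in
/-- A point of the closed convex hull of a compact set `K` of real sequences is the barycentre of
a probability measure on `K`. -/
theorem exists_probabilityMeasure_of_mem_closure_convexHull {ι : Type} [Countable ι]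
    {K : Set (ι → ℝ)} (hK : IsCompact K) {h : ι → ℝ} (hh : h ∈ closure (convexHull ℝ K)) :
    ∃ μ : Measure K, IsProbabilityMeasure μ ∧ ∀ i, h i = ∫ g : K, g.1 i ∂μ := by
  have : CompactSpace K := isCompact_iff_compactSpace.1 hK
  let Φ : ProbabilityMeasure K → ι → ℝ := fun μ i => ∫ g : K, g.1 i ∂(μ : Measure K)
  let ev : ι → C(K, ℝ) := fun i =>
    ⟨fun g => g.1 i, (continuous_apply i).comp continuous_subtype_val⟩
  have hint : ∀ (i : ι) (μ : Measure K) [IsFiniteMeasure μ], Integrable (fun g : K => g.1 i) μ :=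
    fun i μ _ => (ev i).continuous.integrable_of_hasCompactSupport
      (HasCompactSupport.of_compactSpace _)
  have hΦ : Continuous Φ := continuous_pi fun i =>
    ProbabilityMeasure.continuous_integral_continuousMap (ev i)
  have hclosed : IsClosed (Set.range Φ) := (isCompact_range hΦ).isClosed
  have hconv : Convex ℝ (Set.range Φ) := by
    rintro _ ⟨μ, rfl⟩ _ ⟨ν, rfl⟩ a b ha hb hab
    refine ⟨⟨ENNReal.ofReal a • (μ : Measure K) + ENNReal.ofReal b • (ν : Measure K), ⟨?_⟩⟩, ?_⟩
    · simp [← ENNReal.ofReal_add ha hb, hab]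
    · funext i
      change ∫ g : K, g.1 i ∂(ENNReal.ofReal a • (μ : Measure K) +
        ENNReal.ofReal b • (ν : Measure K)) = _
      rw [integral_add_measure ((hint i μ).smul_measure ENNReal.ofReal_ne_top)
        ((hint i ν).smul_measure ENNReal.ofReal_ne_top), integral_smul_measure,
        integral_smul_measure, ENNReal.toReal_ofReal ha, ENNReal.toReal_ofReal hb]
      rfl
  have hsub : K ⊆ Set.range Φ := fun g hg =>
    ⟨⟨Measure.dirac ⟨g, hg⟩, inferInstance⟩, funext fun i => by
      change ∫ g' : K, g'.1 i ∂(Measure.dirac ⟨g, hg⟩) = _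
      rw [integral_dirac]⟩
  obtain ⟨μ, rfl⟩ := closure_minimal (convexHull_min hsub hconv) hclosed hh
  exact ⟨μ, inferInstance, fun i => rfl⟩

/-! ### The action and restrictions -/

/-- The action on `x ∈ c₀₀` of an arbitrary real sequence `h`; it extends `act` to the pointwise
limits of functionals. -/
noncomputable def pair (h : ℕ+ → ℝ) (x : C00) : ℝ := ∑ i ∈ x.support, h i * x i

theorem act_eq_pair (f x : C00) : act f x = pair f x := by
  unfold act pair
  rw [← Finset.sum_subset (Finset.inter_subset_left : f.support ∩ x.support ⊆ f.support),
    ← Finset.sum_subset (Finset.inter_subset_right : f.support ∩ x.support ⊆ x.support)]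
  · intro i hi hn
    simp_all
  · intro i hi hn
    simp_all

theorem act_add (f g x : C00) : act (f + g) x = act f x + act g x := by
  simp [act_eq_pair, pair, add_mul, Finset.sum_add_distrib]

theorem act_smul (c : ℝ) (f x : C00) : act (c • f) x = c * act f x := by
  simp [act_eq_pair, pair, Finset.mul_sum, mul_assoc]

theorem act_neg (f x : C00) : act (-f) x = -act f x := by
  simp [act_eq_pair, pair]

theorem act_sub (f g x : C00) : act (f - g) x = act f x - act g x := by
  rw [sub_eq_add_neg, act_add, act_neg, sub_eq_add_neg]

theorem act_zero (x : C00) : act 0 x = 0 := by simp [act]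

theorem act_sum {ι : Type} (s : Finset ι) (f : ι → C00) (x : C00) :
    act (∑ q ∈ s, f q) x = ∑ q ∈ s, act (f q) x := by
  classical
  induction s using Finset.induction_on with
  | empty => simp [act_zero]
  | insert q s hq ih => rw [Finset.sum_insert hq, Finset.sum_insert hq, act_add, ih]

theorem act_congr {f g x : C00} (h : ∀ i ∈ x.support, f i = g i) : act f x = act g x := by
  rw [act_eq_pair, act_eq_pair]
  exact Finset.sum_congr rfl fun i hi => by rw [h i hi]

theorem act_eq_zero {f x : C00} (h : ∀ i ∈ x.support, f i = 0) : act f x = 0 := by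
  rw [act_congr (g := 0) (fun i hi => by simp [h i hi]), act_zero]

theorem abs_act_le {f x : C00} {c : ℝ} (h : ∀ i, |f i| ≤ c) :
    |act f x| ≤ c * ∑ i ∈ x.support, |x i| := by
  rw [act_eq_pair, pair, Finset.mul_sum]
  refine (Finset.abs_sum_le_sum_abs _ _).trans (Finset.sum_le_sum fun i _ => ?_)
  rw [abs_mul]
  exact mul_le_mul_of_nonneg_right (h i) (abs_nonneg _)

theorem restr_eq_ite (a b : ℕ+) (f : C00) (i : ℕ+) :
    restr a b f i = if a ≤ i ∧ i ≤ b then f i else 0 := by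
  unfold restr
  rw [Finsupp.filter_apply]

/-- Restriction to `{a, …, b}` as a linear map. -/
noncomputable def restrL (a b : ℕ+) : C00 →ₗ[ℝ] C00 where
  toFun := restr a b
  map_add' f g := by ext i; simp only [Finsupp.add_apply, restr_eq_ite]; split_ifs <;> simp
  map_smul' c f := by
    ext i; simp only [Finsupp.smul_apply, restr_eq_ite, RingHom.id_apply]; split_ifs <;> simp

theorem restr_neg (a b : ℕ+) (f : C00) : restr a b (-f) = -restr a b f := by
  exact map_neg (restrL a b) f

theorem restr_smul (a b : ℕ+) (c : ℝ) (f : C00) : restr a b (c • f) = c • restr a b f := by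
  exact map_smul (restrL a b) c f

theorem restr_sum {ι : Type} (a b : ℕ+) (s : Finset ι) (f : ι → C00) :
    restr a b (∑ q ∈ s, f q) = ∑ q ∈ s, restr a b (f q) := by
  exact map_sum (restrL a b) f s

theorem restr_restr (a b c d : ℕ+) (f : C00) :
    restr a b (restr c d f) = restr (max a c) (min b d) f := by
  ext i
  simp only [restr_eq_ite, max_le_iff, le_min_iff]
  split_ifs <;> tauto

theorem support_restr_subset (a b : ℕ+) (f : C00) : (restr a b f).support ⊆ f.support := by
  intro i hi
  rw [Finsupp.mem_support_iff] at hi ⊢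
  rcases restr_apply a b f i with h | h
  · rwa [← h]
  · exact absurd h hi

theorem minSupp_mem {f : C00} (hf : f ≠ 0) : minSupp f ∈ f.support := by
  have h := Finsupp.support_nonempty_iff.2 hf
  rw [minSupp, dif_pos h]
  exact f.support.min'_mem h

theorem minSupp_le {f : C00} {i : ℕ+} (hi : i ∈ f.support) : minSupp f ≤ i := by
  rw [minSupp, dif_pos ⟨i, hi⟩]
  exact f.support.min'_le i hi

theorem maxSupp_mem {f : C00} (hf : f ≠ 0) : maxSupp f ∈ f.support := by
  have h := Finsupp.support_nonempty_iff.2 hf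
  rw [maxSupp, dif_pos h]
  exact f.support.max'_mem h

theorem le_maxSupp {f : C00} {i : ℕ+} (hi : i ∈ f.support) : i ≤ maxSupp f := by
  rw [maxSupp, dif_pos ⟨i, hi⟩]
  exact f.support.le_max' i hi

/-! ### The norming set and its pointwise closure -/

theorem W_neg {P : Choices} {f : C00} (hf : f ∈ W P) : -f ∈ W P := (isNormingClosed_W P).neg f hf

theorem W_restr {P : Choices} {f : C00} (hf : f ∈ W P) (a b : ℕ+) : restr a b f ∈ W P :=
  (isNormingClosed_W P).interval f hf a b

theorem W_zero (P : Choices) : (0 : C00) ∈ W P := by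
  have h := W_restr ((isNormingClosed_W P).basis 1) 2 1
  convert! h
  ext i
  rw [restr_eq_ite, if_neg]
  · rfl
  · rintro ⟨h1, h2⟩
    exact absurd (h1.trans h2) (by decide)

theorem W_smul {P : Choices} {f : C00} (hf : f ∈ W P) (c : ℚ) (hc : |c| ≤ 1) :
    (c : ℝ) • f ∈ W P := by
  have h := (isNormingClosed_W P).convex 2 ![f, -f] ![(1 + c) / 2, (1 - c) / 2]
    (fun j => by fin_cases j; exacts [hf, W_neg hf])
    (fun j => by
      have := abs_le.1 hc
      fin_cases j
      · change 0 ≤ (1 + c) / 2; linarith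
      · change 0 ≤ (1 - c) / 2; linarith)
    (by simp [Fin.sum_univ_two]; ring)
  convert! h using 1
  simp only [Fin.sum_univ_two, Matrix.cons_val_zero, Matrix.cons_val_one, smul_neg]
  rw [← sub_eq_add_neg, ← sub_smul]
  congr 1
  push_cast
  ring

theorem abs_apply_le_one {P : Choices} {f : C00} (hf : f ∈ W P) (i : ℕ+) : |f i| ≤ 1 := by
  obtain ⟨r, hr, h1⟩ := exists_rat_of_mem_W hf i
  rw [hr]
  exact_mod_cast h1

theorem abs_act_le_normX {P : Choices} {f : C00} (hf : f ∈ W P) (x : C00) :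
    |act f x| ≤ normX P x := by
  rw [abs_le']
  exact ⟨le_csSup (bddAbove_act P x) ⟨f, hf, rfl⟩,
    le_csSup (bddAbove_act P x) ⟨-f, W_neg hf, (act_neg f x).symm⟩⟩

/-- The pointwise closure of the norming set. -/
def clW (P : Choices) : Set (ℕ+ → ℝ) := closure ((fun f : C00 => (f : ℕ+ → ℝ)) '' W P)

/-- Elements of `W` have coordinates in `[-1, 1]`, so pointwise closures are compact. -/
theorem isCompact_closure_of_subset_W {P : Choices} {S : Set C00} (hS : S ⊆ W P) :
    IsCompact (closure ((fun f : C00 => (f : ℕ+ → ℝ)) '' S)) := by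
  refine IsCompact.of_isClosed_subset
    (isCompact_univ_pi fun _ : ℕ+ => isCompact_Icc (a := (-1 : ℝ)) (b := 1)) isClosed_closure ?_
  refine closure_minimal ?_ (isClosed_set_pi fun _ _ => isClosed_Icc)
  rintro _ ⟨f, hf, rfl⟩ i -
  exact abs_le.1 (abs_apply_le_one (hS hf) i)

theorem continuous_pair (x : C00) : Continuous fun h : ℕ+ → ℝ => pair h x := by
  unfold pair
  fun_prop

theorem abs_pair_le_of_mem_clW {P : Choices} {h : ℕ+ → ℝ} (hh : h ∈ clW P) (x : C00) :
    |pair h x| ≤ normX P x := by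
  have hcl : IsClosed {h : ℕ+ → ℝ | |pair h x| ≤ normX P x} :=
    isClosed_le (continuous_pair x).abs continuous_const
  refine closure_minimal ?_ hcl hh
  rintro _ ⟨f, hf, rfl⟩
  have := abs_act_le_normX hf x
  rwa [act_eq_pair] at this

/-- Every family in `W` has a pointwise ultralimit in the closure of `W`. -/
theorem exists_mem_clW_tendsto {P : Choices} {ι : Type} (V : Ultrafilter ι) (f : ι → C00)
    (hf : ∀ᶠ t in (V : Filter ι), f t ∈ W P) :
    ∃ h ∈ clW P, ∀ i, Tendsto (fun t => f t i) V (𝓝 (h i)) := by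
  have hc : IsCompact (clW P) := isCompact_closure_of_subset_W subset_rfl
  have hV : (V.map fun t => ((f t : C00) : ℕ+ → ℝ) : Filter (ℕ+ → ℝ)) ≤ 𝓟 (clW P) := by
    rw [le_principal_iff, Ultrafilter.coe_map, Filter.mem_map]
    filter_upwards [hf] with t ht
    exact subset_closure ⟨f t, ht, rfl⟩
  obtain ⟨h, hh, hle⟩ := hc.ultrafilter_le_nhds _ hV
  refine ⟨h, hh, fun i => ?_⟩
  have : Tendsto (fun t => ((f t : C00) : ℕ+ → ℝ)) V (𝓝 h) := hle
  exact (tendsto_pi_nhds.1 this) i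

/-! ### Extremal functionals -/

/-- The functionals `2⁻ⁿ ∑_{p ∈ A} u_p` where `A ∈ 𝒮ₙ`, `u_p ∈ W` and the support of `u_p` lies
between `p` and the next element of `A`. All functionals of type I of weight `n` have this form,
and those of type II have it with `n = 1`. -/
def Mix (P : Choices) (n : ℕ) : Set C00 :=
  {f | ∃ A ∈ schreier n, ∃ u : ℕ+ → C00, (∀ p, u p ∈ W P) ∧
    (∀ p ∈ A, ∀ i ∈ (u p).support, p ≤ i ∧ ∀ p' ∈ A, p < p' → i < p') ∧
    f = (1 / 2 ^ n : ℝ) • ∑ p ∈ A, u p}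

theorem Mix_neg {P : Choices} {n : ℕ} {f : C00} (hf : f ∈ Mix P n) : -f ∈ Mix P n := by
  obtain ⟨A, hA, u, h1, h2, rfl⟩ := hf
  exact ⟨A, hA, fun p => -u p, fun p => W_neg (h1 p),
    fun p hp i hi => h2 p hp i (by simpa using hi), by simp⟩

theorem Mix_restr {P : Choices} {n : ℕ} {f : C00} (hf : f ∈ Mix P n) (a b : ℕ+) :
    restr a b f ∈ Mix P n := by
  obtain ⟨A, hA, u, h1, h2, rfl⟩ := hf
  exact ⟨A, hA, fun p => restr a b (u p), fun p => W_restr (h1 p) a b,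
    fun p hp i hi => h2 p hp i (support_restr_subset a b _ hi), by rw [restr_smul, restr_sum]⟩

/-- Sums of pieces `v q ∈ W` carried by successive vectors `φ q` whose minima form a set in
`𝒮ₙ`. -/
theorem mem_Mix_of_family {P : Choices} {n : ℕ} {ι : Type} (s : Finset ι) (φ v : ι → C00)
    (h0 : ∀ q ∈ s, φ q ≠ 0)
    (hφ : ∀ q ∈ s, ∀ q' ∈ s, q ≠ q' → Precedes (φ q) (φ q') ∨ Precedes (φ q') (φ q))
    (hn : s.image (fun q => minSupp (φ q)) ∈ schreier n)
    (hv : ∀ q ∈ s, v q ∈ W P) (hsupp : ∀ q ∈ s, (v q).support ⊆ (φ q).support) :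
    (1 / 2 ^ n : ℝ) • ∑ q ∈ s, v q ∈ Mix P n := by
  classical
  have hinj : ∀ q ∈ s, ∀ q' ∈ s, minSupp (φ q) = minSupp (φ q') → q = q' := by
    intro q hq q' hq' he
    by_contra hne
    rcases hφ q hq q' hq' hne with h | h
    · exact (h _ (minSupp_mem (h0 q hq)) _ (minSupp_mem (h0 q' hq'))).ne he
    · exact (h _ (minSupp_mem (h0 q' hq')) _ (minSupp_mem (h0 q hq))).ne' he
  let u : ℕ+ → C00 := fun p =>
    if h : ∃ q ∈ s, minSupp (φ q) = p then v h.choose else 0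
  have hu : ∀ q ∈ s, u (minSupp (φ q)) = v q := by
    intro q hq
    have h : ∃ q' ∈ s, minSupp (φ q') = minSupp (φ q) := ⟨q, hq, rfl⟩
    change (if h : _ then _ else _) = _
    rw [dif_pos h, hinj _ h.choose_spec.1 _ hq h.choose_spec.2]
  refine ⟨_, hn, u, fun p => ?_, ?_, ?_⟩
  · change (if h : _ then _ else _) ∈ _
    split_ifs with h
    · exact hv _ h.choose_spec.1
    · exact W_zero P
  · intro p hp i hi
    obtain ⟨q, hq, rfl⟩ := Finset.mem_image.1 hp
    rw [hu q hq] at hi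
    have hi' := hsupp q hq hi
    refine ⟨minSupp_le hi', fun p' hp' hlt => ?_⟩
    obtain ⟨q', hq', rfl⟩ := Finset.mem_image.1 hp'
    have hne : q ≠ q' := by rintro rfl; exact lt_irrefl _ hlt
    rcases hφ q hq q' hq' hne with h | h
    · exact h i hi' _ (minSupp_mem (h0 q' hq'))
    · exact absurd (h _ (minSupp_mem (h0 q' hq')) _ (minSupp_mem (h0 q hq))) hlt.le.not_gt
  · rw [Finset.sum_image (fun q hq q' hq' => hinj q hq q' hq')]
    rw [Finset.sum_congr rfl hu]

theorem mem_Mix_of_successive {P : Choices} {n d : ℕ} {α : Fin d → C00} (h1 : ∀ q, α q ∈ W P)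
    (h2 : Successive α) (h3 : Admissible n Finset.univ α) :
    (1 / 2 ^ n : ℝ) • ∑ q, α q ∈ Mix P n :=
  mem_Mix_of_family Finset.univ α α (fun q _ => h2.1 q)
    (fun q _ q' _ hne => (lt_or_gt_of_ne hne).imp (h2.2 q q') (h2.2 q' q)) h3 (fun q _ => h1 q)
    (fun _ _ => subset_rfl)

/-- All members of the pair of index `p` precede all members of the pair of index `q > p`. -/
theorem IsSpecial.prec_cond {P : Choices} {G : Set C00} {f g : ℕ → C00} {w : ℕ → ℕ} {d : ℕ}
    (h : IsSpecial P G f g w d) {p q : ℕ} (hpq : p < q) (hq : q < d) (s t : Bool) :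
    Precedes (cond s (g p) (f p)) (cond t (g q) (f q)) := by
  have h1 := h.prec hpq hq
  have h2 := (h.precFG p (by omega)).trans' h1 (h.ne_zero p (by omega)).2
  have h3 := h1.trans' (h.precFG q hq) (h.ne_zero q hq).1
  have h4 := h2.trans' (h.precFG q hq) (h.ne_zero q hq).1
  cases s <;> cases t <;> assumption

theorem IsTypeIAlpha.mem_W {P : Choices} {f : C00} {n : ℕ} (h : IsTypeIAlpha (W P) f n) :
    f ∈ W P := by
  obtain ⟨hn, f, hf, a, b, rfl | rfl⟩ := h
  · exact W_restr ((isNormingClosed_W P).alpha n hn hf) a b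
  · exact W_neg (W_restr ((isNormingClosed_W P).alpha n hn hf) a b)

/-- The functionals of type II lie in `Mix P 1`: the restriction `2 #F ≤ min supp f_{min F}`
makes the `2 #F` pieces `𝒮₁`-admissible. -/
theorem SpecialData.Valid.mem_Mix {P : Choices} {D : SpecialData} (hD : D.Valid P (W P))
    (c e : ℕ → ℚ) (hc : ∀ q ∈ D.F, |c q| ≤ 1) (he : ∀ q ∈ D.F, |e q| ≤ 1) :
    (1 / 2 : ℝ) • ∑ q ∈ D.F, ((c q : ℝ) • D.f q + (e q : ℝ) • D.g q) ∈ Mix P 1 := by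
  obtain ⟨hs, hF, hne, hcard⟩ := hD
  let φ : ℕ × Bool → C00 := fun t => cond t.2 (D.g t.1) (D.f t.1)
  let v : ℕ × Bool → C00 := fun t => ((cond t.2 (e t.1) (c t.1) : ℚ) : ℝ) • φ t
  have hφ0 : ∀ t ∈ D.F ×ˢ (Finset.univ : Finset Bool), φ t ≠ 0 := by
    rintro ⟨q, b⟩ ht
    have hq := hs.ne_zero q (hF q (Finset.mem_product.1 ht).1)
    cases b
    exacts [hq.1, hq.2]
  have key := mem_Mix_of_family (P := P) (n := 1) (D.F ×ˢ (Finset.univ : Finset Bool)) φ v hφ0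
    ?_ ?_ ?_ ?_
  · convert! key using 1
    rw [Finset.sum_product]
    simp [v, φ, add_comm]
  · rintro ⟨q, b⟩ ht ⟨q', b'⟩ ht' hne
    have hq := hF q (Finset.mem_product.1 ht).1
    have hq' := hF q' (Finset.mem_product.1 ht').1
    rcases lt_trichotomy q q' with h | rfl | h
    · exact Or.inl (hs.prec_cond h hq' b b')
    · have := hs.precFG q hq
      cases b <;> cases b'
      · exact absurd rfl hne
      · exact Or.inl this
      · exact Or.inr this
      · exact absurd rfl hne
    · exact Or.inr (hs.prec_cond h hq b' b)
  · intro m hm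
    have h1 : (D.F ×ˢ (Finset.univ : Finset Bool)).card = 2 * D.F.card := by
      rw [Finset.card_product]; simp [mul_comm]
    refine (Finset.card_image_le.trans_eq h1).trans (hcard.trans ?_)
    obtain ⟨⟨q, b⟩, ht, rfl⟩ := Finset.mem_image.1 hm
    have hqF := (Finset.mem_product.1 ht).1
    have hq := hF q hqF
    have hmem := minSupp_mem (hφ0 _ ht)
    rw [PNat.coe_le_coe]
    have hmin := hF _ (D.F.min'_mem hne)
    have hmem' := minSupp_mem (hs.ne_zero _ hmin).1
    rcases (D.F.min'_le q hqF).lt_or_eq with h | h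
    · exact (hs.prec_cond h hq false b _ hmem' _ hmem).le
    · rw [h] at hmem' ⊢
      cases b
      · exact le_rfl
      · exact (hs.precFG q hq _ hmem' _ hmem).le
  · rintro ⟨q, b⟩ ht
    have hqF := (Finset.mem_product.1 ht).1
    cases b
    · exact W_smul (hs.typeF q (hF q hqF)).mem_W _ (hc q hqF)
    · exact W_smul (hs.typeG q (hF q hqF)).mem_W _ (he q hqF)
  · intro t _
    exact Finsupp.support_smul

/-- The elements of `W` that are signed unit vectors or have the form of `Mix`. -/
def Gen (P : Choices) : Set C00 :=
  {f | f ∈ W P ∧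
    ((∃ n, 1 ≤ n ∧ f ∈ Mix P n) ∨ ∃ p, f = Finsupp.single p 1 ∨ f = -Finsupp.single p 1)}

theorem Gen_subset_W (P : Choices) : Gen P ⊆ W P := fun _ hf => hf.1

theorem Gen_neg {P : Choices} {f : C00} (hf : f ∈ Gen P) : -f ∈ Gen P := by
  refine ⟨W_neg hf.1, ?_⟩
  rcases hf.2 with ⟨n, hn, hf⟩ | ⟨p, rfl | rfl⟩
  · exact Or.inl ⟨n, hn, Mix_neg hf⟩
  · exact Or.inr ⟨p, Or.inr rfl⟩
  · exact Or.inr ⟨p, Or.inl (neg_neg _)⟩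

theorem zero_mem_Mix_one (P : Choices) : (0 : C00) ∈ Mix P 1 :=
  ⟨∅, by simp [schreier], fun _ => 0, fun _ => W_zero P, by simp, by simp⟩

theorem Gen_restr {P : Choices} {f : C00} (hf : f ∈ Gen P) (a b : ℕ+) : restr a b f ∈ Gen P := by
  have hsingle : ∀ p, restr a b (Finsupp.single p 1) = Finsupp.single p 1 ∨
      restr a b (Finsupp.single p 1) = 0 := by
    intro p
    by_cases h : a ≤ p ∧ p ≤ b
    · exact Or.inl (Finsupp.filter_single_of_pos _ h)
    · exact Or.inr (Finsupp.filter_single_of_neg _ h)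
  refine ⟨W_restr hf.1 a b, ?_⟩
  rcases hf.2 with ⟨n, hn, hf⟩ | ⟨p, rfl | rfl⟩
  · exact Or.inl ⟨n, hn, Mix_restr hf a b⟩
  · rcases hsingle p with h | h
    · exact Or.inr ⟨p, Or.inl h⟩
    · exact Or.inl ⟨1, le_rfl, h ▸ zero_mem_Mix_one P⟩
  · rw [restr_neg]
    rcases hsingle p with h | h
    · exact Or.inr ⟨p, Or.inr (by rw [h])⟩
    · exact Or.inl ⟨1, le_rfl, by rw [h, neg_zero]; exact zero_mem_Mix_one P⟩

theorem image_subset_convexHull {P : Choices} (L : C00 →ₗ[ℝ] C00) (hL : ∀ f ∈ Gen P, L f ∈ Gen P)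
    {f : C00} (hf : f ∈ convexHull ℝ (Gen P)) : L f ∈ convexHull ℝ (Gen P) := by
  have h1 : L f ∈ L '' convexHull ℝ (Gen P) := ⟨f, hf, rfl⟩
  rw [L.image_convexHull] at h1
  refine convexHull_mono ?_ h1
  rintro _ ⟨g, hg, rfl⟩
  exact hL g hg

/-- Convex combinations are the only elements of `W` outside `Gen`. -/
theorem W_subset_convexHull_Gen (P : Choices) : W P ⊆ convexHull ℝ (Gen P) := by
  have hclosed : IsNormingClosed P (W P ∩ convexHull ℝ (Gen P)) := by
    have hW := isNormingClosed_W P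
    have hsub : W P ∩ convexHull ℝ (Gen P) ⊆ W P := Set.inter_subset_left
    have hgen : ∀ {n : ℕ} {f : C00}, f ∈ W P → 1 ≤ n → f ∈ Mix P n → f ∈ convexHull ℝ (Gen P) :=
      fun hf hn hfn => subset_convexHull ℝ _ ⟨hf, Or.inl ⟨_, hn, hfn⟩⟩
    refine ⟨?_, ?_, ?_, ?_, ?_, ?_, ?_, ?_⟩
    · exact fun n => ⟨hW.basis n, subset_convexHull ℝ _ ⟨hW.basis n, Or.inr ⟨n, Or.inl rfl⟩⟩⟩
    · exact fun f hf => ⟨W_neg hf.1, image_subset_convexHull (-LinearMap.id)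
        (fun g hg => Gen_neg hg) hf.2⟩
    · exact fun f hf a b => ⟨W_restr hf.1 a b, image_subset_convexHull (restrL a b)
        (fun g hg => Gen_restr hg a b) hf.2⟩
    · intro m f c h1 h2 h3
      refine ⟨hW.convex m f c (fun j => (h1 j).1) h2 h3, ?_⟩
      exact (convex_convexHull ℝ (Gen P)).sum_mem (fun j _ => by exact_mod_cast h2 j)
        (by exact_mod_cast h3) (fun j _ => (h1 j).2)
    · intro n hn f hf
      have hfW := hW.alpha n hn (alphaOp_mono hsub n hf)
      refine ⟨hfW, ?_⟩
      obtain ⟨d, α, s, g1, g2, g3, rfl⟩ := hf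
      exact hgen hfW hn (mem_Mix_of_successive (fun q => (g1 q).1.1) g2.1 g3)
    · intro n hn f hf
      have hfW := hW.beta n hn (betaOp_mono hsub n hf)
      refine ⟨hfW, ?_⟩
      obtain ⟨d, α, s, g1, g2, g3, rfl⟩ := hf
      exact hgen hfW hn (mem_Mix_of_successive (fun q => (g1 q).1.1) g2.1 g3)
    · intro D hD
      have hD' := hD.mono hsub
      refine ⟨hW.plus D hD', hgen (hW.plus D hD') le_rfl ?_⟩
      simpa [SpecialData.plus] using hD'.mem_Mix (fun _ => 1) (fun _ => 1) (by simp) (by simp)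
    · intro D lam hD hl
      have hD' := hD.mono hsub
      refine ⟨hW.minus D lam hD' hl, hgen (hW.minus D lam hD' hl) le_rfl ?_⟩
      have := hD'.mem_Mix lam (fun q => -lam q) (fun q hq => hl.abs_le hq)
        (fun q hq => by simpa using hl.abs_le hq)
      simpa [SpecialData.minus, smul_sub, sub_eq_add_neg] using this
  exact (Set.sInter_subset_of_mem hclosed).trans Set.inter_subset_right

theorem abs_le_of_mem_Mix {P : Choices} {n : ℕ} {f : C00} (hf : f ∈ Mix P n) (i : ℕ+) :
    |f i| ≤ 1 / 2 ^ n := by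
  obtain ⟨A, -, u, h1, h2, rfl⟩ := hf
  rw [Finsupp.smul_apply, Finsupp.finsetSum_apply, smul_eq_mul, abs_mul,
    abs_of_nonneg (by positivity : (0 : ℝ) ≤ 1 / 2 ^ n)]
  refine mul_le_of_le_one_right (by positivity) ?_
  by_cases hz : ∃ p ∈ A, u p i ≠ 0
  · obtain ⟨p, hp, hpi⟩ := hz
    rw [Finset.sum_eq_single p]
    · exact abs_apply_le_one (h1 p) i
    · intro q hq hne
      by_contra hqi
      have hp' := h2 p hp i (Finsupp.mem_support_iff.2 hpi)
      have hq' := h2 q hq i (Finsupp.mem_support_iff.2 hqi)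
      rcases lt_or_gt_of_ne hne with h | h
      · exact absurd (hq'.2 p hp h) hp'.1.not_gt
      · exact absurd (hp'.2 q hq h) hq'.1.not_gt
    · exact fun hn => absurd hp hn
  · push Not at hz
    rw [Finset.sum_eq_zero hz]
    simp

/-- From some coordinate on, an ultralimit of functionals in `Mix P n` is a multiple by `2⁻ⁿ` of
an ultralimit of functionals in `W`: by compactness of `𝒮ₙ`, all pieces but one escape to
infinity or stay below that coordinate. -/
theorem exists_tail_of_tendsto_Mix {P : Choices} {n : ℕ} (V : Ultrafilter C00)
    (hV : ∀ᶠ f in (V : Filter C00), f ∈ Mix P n) {g : ℕ+ → ℝ}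
    (hg : ∀ i, Tendsto (fun f : C00 => f i) V (𝓝 (g i))) :
    ∃ N : ℕ+, ∃ h ∈ clW P, ∀ i ≥ N, g i = 1 / 2 ^ n * h i := by
  classical
  have hch : ∃ (A : C00 → Finset ℕ+) (u : C00 → ℕ+ → C00), ∀ᶠ f in (V : Filter C00),
      A f ∈ schreier n ∧ (∀ p, u f p ∈ W P) ∧
      (∀ p ∈ A f, ∀ i ∈ (u f p).support, p ≤ i ∧ ∀ p' ∈ A f, p < p' → i < p') ∧
      f = (1 / 2 ^ n : ℝ) • ∑ p ∈ A f, u f p := by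
    have : ∀ f : C00, ∃ (A : Finset ℕ+) (u : ℕ+ → C00), f ∈ Mix P n →
        (A ∈ schreier n ∧ (∀ p, u p ∈ W P) ∧
        (∀ p ∈ A, ∀ i ∈ (u p).support, p ≤ i ∧ ∀ p' ∈ A, p < p' → i < p') ∧
        f = (1 / 2 ^ n : ℝ) • ∑ p ∈ A, u p) := by
      intro f
      by_cases hf : f ∈ Mix P n
      · obtain ⟨A, hA, u, h⟩ := hf
        exact ⟨A, u, fun _ => ⟨hA, h⟩⟩
      · exact ⟨∅, 0, fun h => absurd h hf⟩
    choose A u hAu using this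
    exact ⟨A, u, hV.mono hAu⟩
  obtain ⟨A, u, hAu⟩ := hch
  have hfin := finite_setOf_eventually_mem_of_schreier V n A (hAu.mono fun f hf => hf.1)
  obtain ⟨N₀, hN₀⟩ := hfin.bddAbove
  let N : ℕ+ := N₀ + 1
  -- The piece of `f` that starts last before `N`.
  let v : C00 → C00 := fun f =>
    if h : ((A f).filter (· < N)).Nonempty then u f (((A f).filter (· < N)).max' h) else 0
  have hv : ∀ᶠ f in (V : Filter C00), v f ∈ W P := by
    filter_upwards [hAu] with f hf
    change (if h : _ then _ else _) ∈ _
    split_ifs with h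
    · exact hf.2.1 _
    · exact W_zero P
  obtain ⟨h, hh, hlim⟩ := exists_mem_clW_tendsto V v hv
  refine ⟨N, h, hh, fun i hi => ?_⟩
  have hgap : ∀ᶠ f in (V : Filter C00), ∀ p ∈ Finset.Icc N i, p ∉ A f := by
    refine (Finset.eventually_all _).2 fun p hp => ?_
    rw [Ultrafilter.eventually_not]
    intro hpA
    have h1 := hN₀ hpA
    have h2 := (Finset.mem_Icc.1 hp).1
    exact absurd (h2.trans h1) (PNat.lt_add_right N₀ 1).not_ge
  refine tendsto_nhds_unique (hg i) (((hlim i).const_mul (1 / 2 ^ n : ℝ)).congr' ?_)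
  filter_upwards [hAu, hgap] with f hf hfgap
  have hfi : f i = 1 / 2 ^ n * ∑ p ∈ A f, u f p i := by
    have := congrArg (fun t : C00 => t i) hf.2.2.2
    simpa only [Finsupp.smul_apply, Finsupp.finsetSum_apply, smul_eq_mul] using this
  rw [hfi]
  congr 1
  have hlow : ∀ p ∈ A f, u f p i ≠ 0 → p < N := by
    intro p hp hpi
    by_contra hge
    exact hfgap p (Finset.mem_Icc.2 ⟨not_lt.1 hge,
      (hf.2.2.1 p hp i (Finsupp.mem_support_iff.2 hpi)).1⟩) hp
  change (if h : _ then _ else _ : C00) i = _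
  split_ifs with hne
  · have hm := Finset.mem_filter.1 (((A f).filter (· < N)).max'_mem hne)
    symm
    refine Finset.sum_eq_single_of_mem _ hm.1 fun p hp hpm => ?_
    by_contra hpi
    have hpN := hlow p hp hpi
    have hle := ((A f).filter (· < N)).le_max' p (Finset.mem_filter.2 ⟨hp, hpN⟩)
    have := (hf.2.2.1 p hp i (Finsupp.mem_support_iff.2 hpi)).2 _ hm.1 (lt_of_le_of_ne hle hpm)
    exact absurd (this.trans hm.2) hi.le.not_gt
  · refine (Finset.sum_eq_zero fun p hp => ?_).symm
    by_contra hpi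
    exact hne ⟨p, Finset.mem_filter.2 ⟨hp, hlow p hp hpi⟩⟩

theorem zero_mem_clW (P : Choices) : (0 : ℕ+ → ℝ) ∈ clW P :=
  subset_closure ⟨0, W_zero P, rfl⟩

/-- From some coordinate on, a pointwise limit of extremal functionals is `r h` with `|r| ≤ 1/2`
and `h` in the pointwise closure of `W`. -/
theorem exists_tail_of_mem_closure_Gen {P : Choices} {g : ℕ+ → ℝ}
    (hg : g ∈ closure ((fun f : C00 => (f : ℕ+ → ℝ)) '' Gen P)) :
    ∃ N : ℕ+, ∃ h ∈ clW P, ∃ r : ℝ, |r| ≤ 1 / 2 ∧ ∀ i ≥ N, g i = r * h i := by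
  obtain ⟨u, hu, hle⟩ := mem_closure_iff_ultrafilter.1 hg
  let V := Ultrafilter.ofComapInfPrincipal hu
  have hVmem : ∀ᶠ f in (V : Filter C00), f ∈ Gen P := Ultrafilter.ofComapInfPrincipal_mem hu
  have hVmap : V.map (fun f : C00 => (f : ℕ+ → ℝ)) = u :=
    Ultrafilter.ofComapInfPrincipal_eq_of_map hu
  have hlim' : Tendsto (fun f : C00 => (f : ℕ+ → ℝ)) V (𝓝 g) := by
    rw [Tendsto, ← Ultrafilter.coe_map, hVmap]
    exact hle
  have hlim : ∀ i, Tendsto (fun f : C00 => f i) V (𝓝 (g i)) := tendsto_pi_nhds.1 hlim'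
  have hne : ∀ i, g i ≠ 0 → ∀ᶠ f in (V : Filter C00), f i ≠ 0 := fun i hi =>
    (hlim i).eventually_ne hi
  rcases Ultrafilter.eventually_or.1 (hVmem.mono fun f hf => hf.2) with hmix | hsingle
  · by_cases hn : ∃ n, 1 ≤ n ∧ ∀ᶠ f in (V : Filter C00), f ∈ Mix P n
    · obtain ⟨n, hn1, hn⟩ := hn
      obtain ⟨N, h, hh, hgh⟩ := exists_tail_of_tendsto_Mix V hn hlim
      refine ⟨N, h, hh, 1 / 2 ^ n, ?_, hgh⟩
      rw [abs_of_nonneg (by positivity)]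
      have : (2 : ℝ) ^ 1 ≤ 2 ^ n := pow_le_pow_right₀ (by norm_num) hn1
      gcongr
      linarith
    -- If the weights tend to infinity, the limit vanishes.
    · push Not at hn
      have hlarge : ∀ m : ℕ, ∀ᶠ f in (V : Filter C00), ∃ n ≥ m, f ∈ Mix P n := by
        intro m
        have : ∀ᶠ f in (V : Filter C00), ∀ n ∈ Finset.range m, 1 ≤ n → f ∉ Mix P n := by
          refine (Finset.eventually_all _).2 fun n _ => ?_
          by_cases h1 : 1 ≤ n
          · filter_upwards [hn n h1] with f hf _ using hf
          · exact Eventually.of_forall fun f h => absurd h h1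
        filter_upwards [hmix, this] with f ⟨n, hn1, hf⟩ h2
        refine ⟨n, ?_, hf⟩
        by_contra hlt
        exact h2 n (Finset.mem_range.2 (not_le.1 hlt)) hn1 hf
      have hzero : ∀ i, g i = 0 := by
        intro i
        have hle : ∀ m : ℕ, |g i| ≤ (1 / 2) ^ m := by
          intro m
          refine le_of_tendsto (hlim i).abs ?_
          filter_upwards [hlarge m] with f ⟨n, hnm, hf⟩
          refine (abs_le_of_mem_Mix hf i).trans ?_
          rw [← one_div_pow]
          exact pow_le_pow_of_le_one (by norm_num) (by norm_num) hnm
        have h0 : |g i| ≤ 0 := ge_of_tendsto'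
          (tendsto_pow_atTop_nhds_zero_of_lt_one (by norm_num) (by norm_num)) hle
        exact abs_nonpos_iff.1 h0
      exact ⟨1, 0, zero_mem_clW P, 0, by simp, fun i _ => by simp [hzero i]⟩
  · have huniq : ∀ i j, g i ≠ 0 → g j ≠ 0 → i = j := by
      intro i j hi hj
      obtain ⟨f, ⟨p, hp⟩, h1, h2⟩ := (hsingle.and ((hne i hi).and (hne j hj))).exists
      have hval : ∀ k, f k ≠ 0 → p = k := by
        intro k hk
        by_contra hpk
        rcases hp with rfl | rfl <;> simp [hpk] at hk
      rw [← hval i h1, hval j h2]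
    by_cases hz : ∃ i, g i ≠ 0
    · obtain ⟨i, hi⟩ := hz
      refine ⟨i + 1, 0, zero_mem_clW P, 0, by simp, fun j hj => ?_⟩
      by_contra hgj
      simp only [Pi.zero_apply, mul_zero] at hgj
      rw [← huniq i j hi hgj] at hj
      exact absurd hj (PNat.lt_add_right i 1).not_ge
    · push Not at hz
      exact ⟨1, 0, zero_mem_clW P, 0, by simp, fun i _ => by simp [hz i]⟩

/-- The pointwise closure of `W` is contained in the closed convex hull of the compact set of limits
of extremal functionals. -/
theorem clW_subset_closure_convexHull (P : Choices) :
    clW P ⊆ closure (convexHull ℝ (closure ((fun f : C00 => (f : ℕ+ → ℝ)) '' Gen P))) := by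
  refine closure_mono ?_
  let L : C00 →ₗ[ℝ] (ℕ+ → ℝ) := Finsupp.lcoeFun
  have h1 : (L '' W P) ⊆ L '' convexHull ℝ (Gen P) := Set.image_mono (W_subset_convexHull_Gen P)
  rw [L.image_convexHull] at h1
  exact h1.trans (convexHull_mono subset_closure)

/-! ### Bounded block sequences are weakly null -/

theorem Successive.lt_minSupp {x : ℕ → C00} (hx : Successive x) (k : ℕ) :
    ∀ i ∈ (x k).support, k < (i : ℕ) := by
  induction k with
  | zero => exact fun i _ => i.pos
  | succ k ih =>
    intro i hi
    have h1 := minSupp_mem (hx.1 k)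
    have h2 := hx.2 k (k + 1) (by omega) _ h1 i hi
    have h3 := ih _ h1
    have h4 : ((minSupp (x k) : ℕ+) : ℕ) < i := h2
    omega

open MeasureTheory in
/-- Bounded block sequences converge to zero on every point of the pointwise closure of `W`. For
extremal functionals only one piece, multiplied by at most `1/2`, matters in the limit; by Fatou's
lemma this passes to barycentres. So the largest upper limit is at most half of itself. -/
theorem tendsto_pair_of_mem_clW {P : Choices} {x : ℕ → C00} (hx : IsBoundedBlock P x)
    {h : ℕ+ → ℝ} (hh : h ∈ clW P) : Tendsto (fun k => pair h (x k)) atTop (𝓝 0) := by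
  obtain ⟨hs, C, hC⟩ := hx
  let L : (ℕ+ → ℝ) → ENNReal := fun h => limsup (fun k => ‖pair h (x k)‖ₑ) atTop
  let θ : ENNReal := ⨆ h ∈ clW P, L h
  have hbound : ∀ h ∈ clW P, ∀ k, ‖pair h (x k)‖ₑ ≤ ENNReal.ofReal C := fun h hh k => by
    rw [Real.enorm_eq_ofReal_abs]
    exact ENNReal.ofReal_le_ofReal ((abs_pair_le_of_mem_clW hh (x k)).trans (hC k))
  have hθ : θ ≠ ⊤ := ne_top_of_le_ne_top (ENNReal.ofReal_ne_top (r := C)) <|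
    iSup₂_le fun h hh => limsup_le_of_le (by isBoundedDefault)
      (Eventually.of_forall fun k => hbound h hh k)
  let K : Set (ℕ+ → ℝ) := closure ((fun f : C00 => (f : ℕ+ → ℝ)) '' Gen P)
  have hK : IsCompact K := isCompact_closure_of_subset_W (Gen_subset_W P)
  have hKW : K ⊆ clW P := closure_mono (Set.image_mono (Gen_subset_W P))
  have hextr : ∀ g ∈ K, L g ≤ θ / 2 := by
    intro g hg
    obtain ⟨N, h, hh, r, hr, hgh⟩ := exists_tail_of_mem_closure_Gen hg
    have hev : ∀ᶠ k in atTop, ‖pair g (x k)‖ₑ = ‖r‖ₑ * ‖pair h (x k)‖ₑ := by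
      filter_upwards [eventually_ge_atTop (N : ℕ)] with k hk
      rw [← enorm_mul]
      congr 1
      unfold pair
      rw [Finset.mul_sum]
      refine Finset.sum_congr rfl fun i hi => ?_
      have h1 := hs.lt_minSupp k i hi
      rw [hgh i (PNat.coe_le_coe _ _ |>.1 (by omega)), mul_assoc]
    have hr2 : ‖r‖ₑ ≤ 2⁻¹ := by
      rw [Real.enorm_eq_ofReal_abs, ← ENNReal.ofReal_ofNat, ← ENNReal.ofReal_inv_of_pos two_pos]
      exact ENNReal.ofReal_le_ofReal (by simpa using hr)
    calc L g = limsup (fun k => ‖r‖ₑ * ‖pair h (x k)‖ₑ) atTop := limsup_congr hev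
      _ = ‖r‖ₑ * L h := ENNReal.limsup_const_mul_of_ne_top enorm_ne_top
      _ ≤ 2⁻¹ * θ := mul_le_mul' hr2 (le_iSup₂ (f := fun h (_ : h ∈ clW P) => L h) h hh)
      _ = θ / 2 := by rw [mul_comm, ENNReal.div_eq_inv_mul, mul_comm]
  have hall : ∀ h ∈ clW P, L h ≤ θ / 2 := by
    intro h hh
    obtain ⟨μ, hμ, hμh⟩ := exists_probabilityMeasure_of_mem_closure_convexHull hK
      (clW_subset_closure_convexHull P hh)
    have : CompactSpace K := isCompact_iff_compactSpace.1 hK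
    have hcont : ∀ y : C00, Continuous fun g : K => pair g.1 y := fun y =>
      (continuous_pair y).comp continuous_subtype_val
    have hrep : ∀ y : C00, pair h y = ∫ g : K, pair g.1 y ∂μ := by
      intro y
      unfold pair
      rw [integral_finsetSum]
      · exact Finset.sum_congr rfl fun i _ => by rw [hμh i, integral_mul_const]
      · intro i _
        have hc : Continuous fun g : K => g.1 i * y i :=
          ((continuous_apply i).comp continuous_subtype_val).mul continuous_const
        exact hc.integrable_of_hasCompactSupport (HasCompactSupport.of_compactSpace _)
    calc L h ≤ limsup (fun k => ∫⁻ g : K, ‖pair g.1 (x k)‖ₑ ∂μ) atTop := by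
          refine limsup_le_limsup (Eventually.of_forall fun k => ?_)
          change ‖pair h (x k)‖ₑ ≤ _
          rw [hrep]
          exact enorm_integral_le_lintegral_enorm _
      _ ≤ ∫⁻ g : K, limsup (fun k => ‖pair g.1 (x k)‖ₑ) atTop ∂μ := by
          refine limsup_lintegral_le (fun _ => ENNReal.ofReal C)
            (fun k => (hcont (x k)).enorm.measurable)
            (fun k => Eventually.of_forall fun g => hbound g.1 (hKW g.2) k) ?_
          simp
      _ ≤ ∫⁻ _ : K, θ / 2 ∂μ := lintegral_mono fun g => hextr g.1 g.2
      _ = θ / 2 := by simp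
  have hθ0 : θ = 0 := by
    by_contra h0
    exact absurd (iSup₂_le hall : θ ≤ θ / 2) (ENNReal.half_lt_self h0 hθ).not_ge
  have hL0 : L h = 0 := le_antisymm (hθ0 ▸ le_iSup₂ (f := fun h (_ : h ∈ clW P) => L h) h hh) bot_le
  rw [tendsto_zero_iff_enorm_tendsto_zero]
  exact tendsto_of_le_liminf_of_limsup_le bot_le hL0.le

/-! ### Special sequences -/

theorem Precedes.mem_support_add {f g : C00} (h : Precedes f g) (i : ℕ+) :
    i ∈ (f + g).support ↔ i ∈ f.support ∨ i ∈ g.support := by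
  simp only [Finsupp.mem_support_iff, Finsupp.add_apply]
  rcases h.eq_zero i with h0 | h0 <;> simp [h0]

theorem mem_ran_of_mem_support {f : C00} {i : ℕ+} (hi : i ∈ f.support) : i ∈ ran f :=
  ⟨i, hi, i, hi, le_rfl, le_rfl⟩

/-- Functionals of type I of weight `n` have coordinates at most `2⁻ⁿ` in absolute value. -/
theorem IsTypeIAlpha.abs_le {P : Choices} {f : C00} {n : ℕ} (h : IsTypeIAlpha (W P) f n)
    (i : ℕ+) : |f i| ≤ 1 / 2 ^ n := by
  obtain ⟨-, f, ⟨d, α, s, h1, h2, h3, rfl⟩, a, b, hf⟩ := h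
  have hM := mem_Mix_of_successive (fun q => (h1 q).1) h2.1 h3
  rcases hf with rfl | rfl
  · exact abs_le_of_mem_Mix (Mix_restr hM a b) i
  · exact abs_le_of_mem_Mix (Mix_neg (Mix_restr hM a b)) i

/-- The list `f₀, g₀, …, f_{q-1}, g_{q-1}` to which the coding function is applied. -/
def pairList (f g : ℕ → C00) (q : ℕ) : List C00 := (List.range q).flatMap fun i => [f i, g i]

theorem pairList_succ (f g : ℕ → C00) (q : ℕ) :
    pairList f g (q + 1) = pairList f g q ++ [f q, g q] := by
  simp [pairList, List.range_succ]

theorem length_pairList (f g : ℕ → C00) (q : ℕ) : (pairList f g q).length = 2 * q := by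
  induction q with
  | zero => simp [pairList]
  | succ q ih => rw [pairList_succ, List.length_append, ih]; simp; ring

theorem mem_pairList {f g : ℕ → C00} {q : ℕ} {u : C00} (hu : u ∈ pairList f g q) :
    ∃ i < q, ∃ t : Bool, u = cond t (g i) (f i) := by
  simp only [pairList, List.mem_flatMap, List.mem_range, List.mem_cons, List.not_mem_nil,
    or_false] at hu
  obtain ⟨i, hi, rfl | rfl⟩ := hu
  exacts [⟨i, hi, false, rfl⟩, ⟨i, hi, true, rfl⟩]

theorem eq_of_pairList_eq {f g f' g' : ℕ → C00} {q : ℕ}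
    (h : pairList f g q = pairList f' g' q) : ∀ i < q, f i = f' i ∧ g i = g' i := by
  induction q with
  | zero => exact fun i hi => absurd hi (Nat.not_lt_zero i)
  | succ q ih =>
    rw [pairList_succ, pairList_succ] at h
    obtain ⟨h1, h2⟩ := List.append_inj' h rfl
    intro i hi
    rcases Nat.lt_succ_iff_lt_or_eq.1 hi with hi | rfl
    · exact ih h1 i hi
    · simpa using h2

section

variable {P : Choices} {f g : ℕ → C00} {w : ℕ → ℕ} {d : ℕ}

theorem IsSpecial.cond_ne_zero (h : IsSpecial P (W P) f g w d) {q : ℕ} (hq : q < d) (t : Bool) :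
    cond t (g q) (f q) ≠ 0 := by
  cases t
  exacts [(h.ne_zero q hq).1, (h.ne_zero q hq).2]

theorem IsSpecial.lt_of_mem_support (h : IsSpecial P (W P) f g w d) {q : ℕ} (hq : q < d)
    (t : Bool) : ∀ i ∈ (cond t (g q) (f q)).support, q < (i : ℕ) := by
  induction q generalizing t with
  | zero => exact fun i _ => i.pos
  | succ q ih =>
    intro i hi
    have h1 := minSupp_mem (h.cond_ne_zero (q := q) (by omega) true)
    have h2 := ih (by omega) true _ h1
    have h3 := h.prec_cond (Nat.lt_succ_self q) hq true t _ h1 i hi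
    rw [← PNat.coe_lt_coe] at h3
    omega

theorem IsSpecial.mem_ran (h : IsSpecial P (W P) f g w d) {q : ℕ} (hq : q < d) {i : ℕ+}
    (hi : i ∈ (f q).support ∨ i ∈ (g q).support) : i ∈ ran (f q + g q) :=
  mem_ran_of_mem_support (((h.precFG q hq).mem_support_add i).2 hi)

theorem IsSpecial.ran_lt (h : IsSpecial P (W P) f g w d) {p q : ℕ} (hpq : p < q) (hq : q < d)
    {i j : ℕ+} (hi : i ∈ ran (f p + g p)) (hj : j ∈ ran (f q + g q)) : i < j := by
  obtain ⟨-, -, b, hb, -, hib⟩ := hi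
  obtain ⟨a, ha, -, -, haj, -⟩ := hj
  rw [(h.precFG p (by omega)).mem_support_add] at hb
  rw [(h.precFG q hq).mem_support_add] at ha
  have hlt : b < a := by
    rcases hb with hb | hb <;> rcases ha with ha | ha
    · exact h.prec_cond hpq hq false false b hb a ha
    · exact h.prec_cond hpq hq false true b hb a ha
    · exact h.prec_cond hpq hq true false b hb a ha
    · exact h.prec_cond hpq hq true true b hb a ha
  exact hib.trans_lt (hlt.trans_le haj)

theorem IsSpecial.cond_mem_W (h : IsSpecial P (W P) f g w d) {q : ℕ} (hq : q < d) (t : Bool) :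
    cond t (g q) (f q) ∈ W P := by
  cases t
  exacts [(h.typeF q hq).mem_W, (h.typeG q hq).mem_W]

theorem IsSpecial.pairList_mem (h : IsSpecial P (W P) f g w d) {q : ℕ} (h0 : 0 < q)
    (hq : q ≤ d) : pairList f g q ∈ RatSeqs := by
  refine ⟨?_, ?_, ?_⟩
  · intro hnil
    have := length_pairList f g q
    rw [hnil] at this
    simp at this
    omega
  · intro u hu
    obtain ⟨i, hi, t, rfl⟩ := mem_pairList hu
    refine ⟨h.cond_ne_zero (by omega) t, fun j => ?_⟩
    obtain ⟨r, hr, -⟩ := exists_rat_of_mem_W (h.cond_mem_W (q := i) (by omega) t) j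
    exact ⟨r, hr⟩
  · clear h0
    induction q with
    | zero => simp [pairList]
    | succ q ih =>
      rw [pairList_succ, List.pairwise_append]
      refine ⟨ih (by omega), by simpa using h.precFG q (by omega), ?_⟩
      intro u hu v hv
      obtain ⟨i, hi, t, rfl⟩ := mem_pairList hu
      simp only [List.mem_cons, List.not_mem_nil, or_false] at hv
      rcases hv with rfl | rfl
      · exact h.prec_cond hi (by omega) t false
      · exact h.prec_cond hi (by omega) t true

theorem IsSpecial.coding_pairList (h : IsSpecial P (W P) f g w d) {q : ℕ} (h0 : 0 < q)
    (hq : q < d) : P.coding (pairList f g q) = w q := h.weight_next q h0 hq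

/-- As `σ` is one-to-one, the weight of a pair determines its position and all earlier pairs. -/
theorem IsSpecial.eq_of_weight_eq (h : IsSpecial P (W P) f g w d) {f' g' : ℕ → C00} {w' : ℕ → ℕ}
    {d' : ℕ} (h' : IsSpecial P (W P) f' g' w' d') {q q' : ℕ} (hq : q < d) (hq' : q' < d')
    (hw : w q = w' q') : q = q' ∧ ∀ i < q, f i = f' i ∧ g i = g' i := by
  have hL₂ : ∀ {f g : ℕ → C00} {w : ℕ → ℕ} {d : ℕ}, IsSpecial P (W P) f g w d → ∀ {q}, 0 < q →
      q < d → w q ∈ P.L₂ := fun h _ h0 hq => by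
    rw [← h.coding_pairList h0 hq]
    exact P.coding_mapsTo (h.pairList_mem h0 hq.le)
  have hdis := Set.disjoint_left.1 P.disjoint₁₂
  rcases Nat.eq_zero_or_pos q with rfl | h0
  · refine ⟨?_, fun i hi => absurd hi (Nat.not_lt_zero i)⟩
    by_contra hne
    exact hdis h.weight_first (hw ▸ hL₂ h' (by omega) hq')
  · rcases Nat.eq_zero_or_pos q' with rfl | h0'
    · exact absurd (hL₂ h h0 hq) (hdis (hw ▸ h'.weight_first))
    have he : pairList f g q = pairList f' g' q' := by
      refine P.coding_injOn (h.pairList_mem h0 hq.le) (h'.pairList_mem h0' hq'.le) ?_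
      rw [h.coding_pairList h0 hq, h'.coding_pairList h0' hq', hw]
    have hlen := congrArg List.length he
    rw [length_pairList, length_pairList] at hlen
    obtain rfl : q = q' := by omega
    exact ⟨rfl, eq_of_pairList_eq he⟩

/-- Weights increase along special sequences, by the growth condition on `σ`. -/
theorem IsSpecial.weight_lt_succ (h : IsSpecial P (W P) f g w d) {q : ℕ} (hq : q + 1 < d) :
    w q < w (q + 1) := by
  have hmem := h.pairList_mem (Nat.succ_pos q) hq.le
  have hgrow := P.coding_growth _ hmem.1 hmem
  have hlast : (pairList f g (q + 1)).getLast hmem.1 = g q := by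
    simp [pairList_succ]
  rw [hlast, h.coding_pairList (Nat.succ_pos q) hq] at hgrow
  have hg0 := (h.ne_zero q (by omega)).2
  have hle : supNorm (g q) ≤ 1 / 2 ^ w q := by
    have : ((g q).support.sup fun i => ‖g q i‖₊) ≤ (1 / 2 ^ w q : ℝ≥0) := by
      refine Finset.sup_le fun i _ => ?_
      rw [← NNReal.coe_le_coe]
      simpa using (h.typeG q (by omega)).abs_le i
    rw [← NNReal.coe_le_coe] at this
    simpa [supNorm] using this
  have hpos : 0 < supNorm (g q) := by
    have hm := minSupp_mem hg0
    have : ‖g q (minSupp (g q))‖₊ ≤ (g q).support.sup fun i => ‖g q i‖₊ :=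
      Finset.le_sup (f := fun i => ‖g q i‖₊) hm
    refine lt_of_lt_of_le ?_ (NNReal.coe_le_coe.2 this)
    simpa using hm
  have h1 : (2 : ℝ) ^ w q ≤ 1 / supNorm (g q) := by
    rw [le_div_iff₀ hpos]
    calc (2 : ℝ) ^ w q * supNorm (g q) ≤ 2 ^ w q * (1 / 2 ^ w q) := by gcongr
      _ = 1 := by field_simp
  have h2 : (w q : ℝ) < 2 ^ w q := by exact_mod_cast Nat.lt_two_pow_self
  have h3 : (2 : ℝ) ^ w q ≤ 2 ^ (1 / supNorm (g q)) := by
    rw [← Real.rpow_natCast]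
    exact Real.rpow_le_rpow_of_exponent_le (by norm_num) (h2.le.trans h1)
  have h4 : (1 : ℝ) ≤ ((maxSupp (g q) : ℕ) : ℝ) := by exact_mod_cast (maxSupp (g q)).pos
  have h5 : (w q : ℝ) < w (q + 1) :=
    calc (w q : ℝ) < 2 ^ (1 / supNorm (g q)) * 1 := by rw [mul_one]; exact h2.trans_le h3
      _ ≤ 2 ^ (1 / supNorm (g q)) * ((maxSupp (g q) : ℕ) : ℝ) := by gcongr
      _ < w (q + 1) := hgrow
  exact_mod_cast h5

theorem IsSpecial.weight_mono (h : IsSpecial P (W P) f g w d) {p q : ℕ} (hpq : p ≤ q)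
    (hq : q < d) : w p ≤ w q := by
  induction q, hpq using Nat.le_induction with
  | base => exact le_rfl
  | succ q _ ih => exact (ih (by omega)).trans (h.weight_lt_succ hq).le

end

/-! ### Functionals of type II -/

/-- Functionals of types II₊ and II₋ written in a common form. -/
theorem IsTypeII.exists_repr {P : Choices} {D : SpecialData} {a b : ℕ+} {h : C00}
    (hh : IsTypeII P (W P) D a b h) : ∃ τ : ℝ, (τ = 1 ∨ τ = -1) ∧ ∃ c : ℕ → ℝ,
      (∀ q ∈ D.F, |c q| ≤ 1) ∧
      h = restr a b ((1 / 2 : ℝ) • ∑ q ∈ D.F, c q • (D.f q + τ • D.g q)) := by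
  rcases hh with ⟨-, rfl | rfl⟩ | ⟨-, lam, hl, rfl | rfl⟩
  · refine ⟨1, Or.inl rfl, fun _ => 1, by simp, ?_⟩
    simp [SpecialData.plus]
  · refine ⟨1, Or.inl rfl, fun _ => -1, by simp, ?_⟩
    rw [← restr_neg]
    simp [SpecialData.plus, Finset.sum_add_distrib, add_comm]
  · refine ⟨-1, Or.inr rfl, fun q => lam q, fun q hq => ?_, ?_⟩
    · change |(lam q : ℝ)| ≤ 1; exact_mod_cast hl.abs_le hq
    · simp [SpecialData.minus, sub_eq_add_neg]
  · refine ⟨-1, Or.inr rfl, fun q => -lam q, fun q hq => ?_, ?_⟩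
    · rw [abs_neg]; exact_mod_cast hl.abs_le hq
    · rw [← restr_neg, SpecialData.minus, ← smul_neg, ← Finset.sum_neg_distrib]
      simp [sub_eq_add_neg, add_comm]

theorem IsTypeII.valid {P : Choices} {D : SpecialData} {a b : ℕ+} {h : C00}
    (hh : IsTypeII P (W P) D a b h) : D.Valid P (W P) :=
  hh.elim (fun h => h.1) (fun h => h.1)

theorem IsTypeII.neg {P : Choices} {D : SpecialData} {a b : ℕ+} {h : C00}
    (hh : IsTypeII P (W P) D a b h) : IsTypeII P (W P) D a b (-h) := by
  rcases hh with ⟨hD, rfl | rfl⟩ | ⟨hD, lam, hl, rfl | rfl⟩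
  · exact Or.inl ⟨hD, Or.inr rfl⟩
  · exact Or.inl ⟨hD, Or.inl (neg_neg _)⟩
  · exact Or.inr ⟨hD, lam, hl, Or.inr rfl⟩
  · exact Or.inr ⟨hD, lam, hl, Or.inl (neg_neg _)⟩

theorem IsTypeII.restr {P : Choices} {D : SpecialData} {a b : ℕ+} {h : C00}
    (hh : IsTypeII P (W P) D a b h) (a' b' : ℕ+) :
    IsTypeII P (W P) D (max a' a) (min b' b) (SpreadHI.restr a' b' h) := by
  rcases hh with ⟨hD, rfl | rfl⟩ | ⟨hD, lam, hl, rfl | rfl⟩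
  · exact Or.inl ⟨hD, Or.inl (restr_restr ..)⟩
  · exact Or.inl ⟨hD, Or.inr (by rw [restr_neg, restr_restr])⟩
  · exact Or.inr ⟨hD, lam, hl, Or.inl (restr_restr ..)⟩
  · exact Or.inr ⟨hD, lam, hl, Or.inr (by rw [restr_neg, restr_restr])⟩

theorem IsTypeII.mem_W {P : Choices} {D : SpecialData} {a b : ℕ+} {h : C00}
    (hh : IsTypeII P (W P) D a b h) : h ∈ W P := by
  have hW := isNormingClosed_W P
  rcases hh with ⟨hD, rfl | rfl⟩ | ⟨hD, lam, hl, rfl | rfl⟩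
  · exact W_restr (hW.plus D hD) a b
  · exact W_neg (W_restr (hW.plus D hD) a b)
  · exact W_restr (hW.minus D lam hD hl) a b
  · exact W_neg (W_restr (hW.minus D lam hD hl) a b)

theorem Successive.lt_of_mem_ran {x : ℕ → C00} (hx : Successive x) {k l : ℕ} (hkl : k < l)
    {i j : ℕ+} (hi : i ∈ ran (x k)) (hj : j ∈ ran (x l)) : i < j := by
  obtain ⟨-, -, b, hb, -, hib⟩ := hi
  obtain ⟨a, ha, -, -, haj, -⟩ := hj
  exact hib.trans_lt ((hx.2 k l hkl b hb a ha).trans_le haj)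

/-! ### Separating functionals with large values -/

/-- The functional `f` of type II, represented by `D` and `{a, …, b}`, separates
`x_{k₀}, x_k, x_m`, where `q₀` is the index of the first pair that meets `ran x_k`, and its values
at `x_k` and `x_m` are at least `ε` in absolute value. Of `x_{k₀}` only the fact that `f` meets its
range is recorded, which bounds the number of pairs of `f`. -/
structure IsBad (P : Choices) (x : ℕ → C00) (ε : ℝ) (k₀ k m : ℕ) (D : SpecialData) (a b : ℕ+)
    (f : C00) (q₀ : ℕ) : Prop where
  lt₁ : k₀ < k
  lt₂ : k < m
  typeII : IsTypeII P (W P) D a b f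
  meets₁ : ((f.support : Set ℕ+) ∩ ran (x k₀)).Nonempty
  meets₃ : ((f.support : Set ℕ+) ∩ ran (x m)).Nonempty
  least : IsLeast {q | q ∈ D.F ∧ (ran (D.f q + D.g q) ∩ ran (x k)).Nonempty} q₀
  misses : ran (D.f q₀ + D.g q₀) ∩ ran (x m) = ∅
  le₂ : ε ≤ |act f (x k)|
  le₃ : ε ≤ |act f (x m)|

section

variable {P : Choices} {x : ℕ → C00} {ε : ℝ} {k₀ k m : ℕ} {D : SpecialData} {a b : ℕ+} {f : C00}
  {q₀ : ℕ}

theorem IsBad.special (h : IsBad P x ε k₀ k m D a b f q₀) :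
    IsSpecial P (W P) D.f D.g D.w D.d := h.typeII.valid.1

theorem IsBad.lt_d (h : IsBad P x ε k₀ k m D a b f q₀) {q : ℕ} (hq : q ∈ D.F) : q < D.d :=
  h.typeII.valid.2.1 q hq

/-- As `f` acts on `x_{k₀}`, the number of its pairs is controlled by `x_{k₀}`. -/
theorem IsBad.card_le (h : IsBad P x ε k₀ k m D a b f q₀) :
    2 * D.F.card ≤ (maxSupp (x k₀) : ℕ) := by
  obtain ⟨τ, -, c, -, hf⟩ := h.typeII.exists_repr
  obtain ⟨i, hi, hir⟩ := h.meets₁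
  have hfi : f i ≠ 0 := Finsupp.mem_support_iff.1 hi
  have hex : ∃ q ∈ D.F, D.f q i ≠ 0 ∨ D.g q i ≠ 0 := by
    by_contra! hno
    apply hfi
    rw [hf]
    rcases restr_apply a b ((1 / 2 : ℝ) • ∑ q ∈ D.F, c q • (D.f q + τ • D.g q)) i with h0 | h0
    · rw [h0, Finsupp.smul_apply, Finsupp.finsetSum_apply, Finset.sum_eq_zero, smul_zero]
      intro q hq
      simp [hno q hq]
    · exact h0
  obtain ⟨q, hq, hqi⟩ := hex
  obtain ⟨hs, hF, hne, hcard⟩ := h.typeII.valid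
  have hi' : i ∈ (D.f q).support ∨ i ∈ (D.g q).support := by simpa using hqi
  have hmem := minSupp_mem (hs.ne_zero _ (hF _ (D.F.min'_mem hne))).1
  have h1 : minSupp (D.f (D.F.min' hne)) ≤ i := by
    rcases (D.F.min'_le q hq).lt_or_eq with hlt | heq
    · rcases hi' with hi' | hi'
      · exact (hs.prec_cond hlt (hF q hq) false false _ hmem _ hi').le
      · exact (hs.prec_cond hlt (hF q hq) false true _ hmem _ hi').le
    · rw [heq] at hmem ⊢
      rcases hi' with hi' | hi'
      · exact minSupp_le hi'
      · exact (hs.precFG q (hF q hq) _ hmem _ hi').le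
  have h2 : i ≤ maxSupp (x k₀) := by
    obtain ⟨-, -, e, he, -, hie⟩ := hir
    exact hie.trans (le_maxSupp he)
  exact hcard.trans (PNat.coe_le_coe _ _ |>.2 (h1.trans h2))

/-- The middle vector is not affected by the restriction to `{a, …, b}`. -/
theorem IsBad.mem_interval (hx : Successive x) (h : IsBad P x ε k₀ k m D a b f q₀) {i : ℕ+}
    (hi : i ∈ (x k).support) : a ≤ i ∧ i ≤ b := by
  obtain ⟨τ, -, c, -, hf⟩ := h.typeII.exists_repr
  have key : ∀ j ∈ f.support, a ≤ j ∧ j ≤ b := by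
    intro j hj
    rw [Finsupp.mem_support_iff, hf, restr_eq_ite] at hj
    by_contra hn
    exact hj (if_neg hn)
  obtain ⟨j, hj, hjr⟩ := h.meets₁
  obtain ⟨l, hl, hlr⟩ := h.meets₃
  have hir := mem_ran_of_mem_support hi
  exact ⟨(key j hj).1.trans (hx.lt_of_mem_ran h.lt₁ hjr hir).le,
    (hx.lt_of_mem_ran h.lt₂ hir hlr).le.trans (key l hl).2⟩

/-- Some single pair, from index `q₀` on, is responsible for a fixed portion of `f(x_k)`. -/
theorem IsBad.exists_pair (hx : Successive x) (hε : 0 < ε)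
    (h : IsBad P x ε k₀ k m D a b f q₀) :
    ∃ q ∈ D.F, q₀ ≤ q ∧ (∃ i ∈ (x k).support, i ∈ ran (D.f q + D.g q) ∧ q < (i : ℕ)) ∧
      (ε ≤ (maxSupp (x k₀) : ℕ) * |act (D.f q + D.g q) (x k)| ∨
        ε ≤ (maxSupp (x k₀) : ℕ) * |act (D.f q - D.g q) (x k)|) := by
  obtain ⟨τ, hτ, c, hc, hf⟩ := h.typeII.exists_repr
  have hact : act f (x k) = 1 / 2 * ∑ q ∈ D.F, c q * act (D.f q + τ • D.g q) (x k) := by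
    rw [hf, act_congr (g := (1 / 2 : ℝ) • ∑ q ∈ D.F, c q • (D.f q + τ • D.g q)), act_smul, act_sum]
    · simp only [act_smul]
    · intro i hi
      rw [restr_eq_ite, if_pos (h.mem_interval hx hi)]
  have hbig : ∃ q ∈ D.F, ε ≤ (maxSupp (x k₀) : ℕ) * |act (D.f q + τ • D.g q) (x k)| := by
    by_contra! hno
    have hN : (0 : ℝ) < (maxSupp (x k₀) : ℕ) := by exact_mod_cast (maxSupp (x k₀)).pos
    have hle : |act f (x k)| ≤ 1 / 2 * (D.F.card * (ε / (maxSupp (x k₀) : ℕ))) := by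
      rw [hact, abs_mul, abs_of_nonneg (by norm_num : (0 : ℝ) ≤ 1 / 2)]
      gcongr
      refine (Finset.abs_sum_le_sum_abs _ _).trans ?_
      rw [← nsmul_eq_mul]
      refine Finset.sum_le_card_nsmul _ _ _ fun q hq => ?_
      rw [abs_mul]
      refine (mul_le_of_le_one_left (abs_nonneg _) (hc q hq)).trans ?_
      rw [le_div_iff₀ hN, mul_comm]
      exact (hno q hq).le
    have hcard : (2 : ℝ) * D.F.card ≤ (maxSupp (x k₀) : ℕ) := by exact_mod_cast h.card_le
    have h3 : 1 / 2 * (D.F.card * (ε / (maxSupp (x k₀) : ℕ))) ≤ ε / 4 := by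
      have : (D.F.card : ℝ) / (maxSupp (x k₀) : ℕ) ≤ 1 / 2 := by
        rw [div_le_iff₀ hN]; linarith
      calc 1 / 2 * (D.F.card * (ε / (maxSupp (x k₀) : ℕ)))
          = (D.F.card : ℝ) / (maxSupp (x k₀) : ℕ) * (ε / 2) := by ring
        _ ≤ 1 / 2 * (ε / 2) := by gcongr
        _ = ε / 4 := by ring
    have := h.le₂
    linarith
  obtain ⟨q, hq, hqε⟩ := hbig
  have hne : ∃ i ∈ (x k).support, D.f q i ≠ 0 ∨ D.g q i ≠ 0 := by
    by_contra! hno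
    rw [act_eq_zero (fun i hi => by simp [hno i hi])] at hqε
    simp at hqε
    linarith
  obtain ⟨i, hi, hqi⟩ := hne
  have hi' : i ∈ (D.f q).support ∨ i ∈ (D.g q).support := by simpa using hqi
  have hir := h.special.mem_ran (h.lt_d hq) hi'
  refine ⟨q, hq, h.least.2 ⟨hq, i, hir, mem_ran_of_mem_support hi⟩, ⟨i, hi, hir, ?_⟩, ?_⟩
  · rcases hi' with hi' | hi'
    · exact h.special.lt_of_mem_support (h.lt_d hq) false i hi'
    · exact h.special.lt_of_mem_support (h.lt_d hq) true i hi'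
  · rcases hτ with rfl | rfl
    · left; simpa using hqε
    · right; simpa [sub_eq_add_neg] using hqε

/-- The weight at index `q₀` is bounded in terms of `x_{k₀}` and `x_k` only. -/
theorem IsBad.weight_lt (hx : Successive x) (hε : 0 < ε) (k₀ k : ℕ) : ∃ B : ℕ,
    ∀ {m : ℕ} {D : SpecialData} {a b : ℕ+} {f : C00} {q₀ : ℕ},
      IsBad P x ε k₀ k m D a b f q₀ → D.w q₀ < B := by
  let S : ℝ := ∑ i ∈ (x k).support, |x k i|
  have hS : 0 ≤ S := Finset.sum_nonneg fun i _ => abs_nonneg _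
  let N : ℝ := (maxSupp (x k₀) : ℕ)
  have hN : 0 ≤ N := Nat.cast_nonneg _
  obtain ⟨B, hB⟩ := exists_pow_lt_of_lt_one (y := (1 / 2 : ℝ)) (x := ε / (2 * N * S + 1))
    (by positivity) (by norm_num)
  refine ⟨B, fun {m D a b f q₀} h => ?_⟩
  by_contra hge
  push Not at hge
  obtain ⟨q, hq, hq₀, -, hε'⟩ := h.exists_pair hx hε
  have hw : B ≤ D.w q := hge.trans (h.special.weight_mono hq₀ (h.lt_d hq))
  have hpow : (1 : ℝ) / 2 ^ D.w q ≤ (1 / 2) ^ B := by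
    rw [← one_div_pow]
    exact pow_le_pow_of_le_one (by norm_num) (by norm_num) hw
  have hf := abs_act_le (x := x k) (fun i => ((h.special.typeF q (h.lt_d hq)).abs_le i).trans hpow)
  have hg := abs_act_le (x := x k) (fun i => ((h.special.typeG q (h.lt_d hq)).abs_le i).trans hpow)
  have hle : ε ≤ N * (2 * ((1 / 2) ^ B * S)) := by
    rcases hε' with h1 | h1
    · refine h1.trans ?_
      rw [act_add]
      gcongr
      exact (abs_add_le _ _).trans (by linarith)
    · refine h1.trans ?_
      rw [act_sub]
      gcongr
      exact (abs_sub _ _).trans (by linarith)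
  rw [lt_div_iff₀ (by positivity)] at hB
  have : (0 : ℝ) < (1 / 2) ^ B := by positivity
  nlinarith

/-- All pairs of `f` that meet `ran x_m` come after the pair of index `q₀`. -/
theorem IsBad.lt_of_meets (hx : Successive x) (h : IsBad P x ε k₀ k m D a b f q₀) {q : ℕ}
    (hm : (ran (D.f q + D.g q) ∩ ran (x m)).Nonempty) : q₀ < q := by
  obtain ⟨i, hi, him⟩ := hm
  obtain ⟨⟨hq₀F, j, hj, hjk⟩, -⟩ := h.least
  rcases lt_trichotomy q q₀ with hlt | rfl | hlt
  · exact absurd (h.special.ran_lt hlt (h.lt_d hq₀F) hi hj)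
      (hx.lt_of_mem_ran h.lt₂ hjk him).le.not_gt
  · have : i ∈ ran (D.f q + D.g q) ∩ ran (x m) := ⟨hi, him⟩
    rw [h.misses] at this
    exact absurd this (Set.notMem_empty i)
  · exact hlt

end

/-- The weights of the restriction to the range of `y` of a functional that is represented by `D` and
`{a, …, b}`. -/
def weightsOn (y : C00) (D : SpecialData) (a b : ℕ+) : Set ℕ :=
  D.weights (max (minSupp y) a) (min (maxSupp y) b)

/-- The sequences of pairs of `D` and `D'` agree before the index `q`. -/
def AgreeBelow (D D' : SpecialData) (q : ℕ) : Prop := ∀ i < q, D.f i = D'.f i ∧ D.g i = D'.g i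

/-- If the weights on `x_m` of two such functionals are not disjoint, then both special sequences
agree up to the indices `q₀` and `q₀'`. -/
theorem IsBad.disjoint_or_agree {P : Choices} {x : ℕ → C00} (hx : Successive x) {ε : ℝ}
    {k₀ k l m : ℕ} {D D' : SpecialData} {a b a' b' : ℕ+} {f f' : C00} {q₀ q₀' : ℕ}
    (h : IsBad P x ε k₀ k m D a b f q₀) (h' : IsBad P x ε k₀ l m D' a' b' f' q₀') :
    Disjoint (weightsOn (x m) D a b) (weightsOn (x m) D' a' b') ∨
      AgreeBelow D D' (q₀ + 1) ∧ AgreeBelow D D' (q₀' + 1) := by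
  rw [or_iff_not_imp_left, Set.not_disjoint_iff]
  rintro ⟨_, ⟨q, hq, ⟨i, hi, hi'⟩, rfl⟩, q', hq', ⟨j, hj, hj'⟩, hw⟩
  have hran : ∀ {i a b}, i ∈ Set.Icc (max (minSupp (x m)) a) (min (maxSupp (x m)) b) →
      i ∈ ran (x m) := fun {i a b} hi => by
    rw [Set.mem_Icc, max_le_iff, le_min_iff] at hi
    exact ⟨_, minSupp_mem (hx.1 m), _, maxSupp_mem (hx.1 m), hi.1.1, hi.2.1⟩
  have hlt := h.lt_of_meets hx ⟨i, hi, hran hi'⟩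
  have hlt' := h'.lt_of_meets hx ⟨j, hj, hran hj'⟩
  obtain ⟨rfl, hagree⟩ := h.special.eq_of_weight_eq h'.special (h.lt_d hq) (h'.lt_d hq') hw
  exact ⟨fun i hi => hagree i (by omega), fun i hi => hagree i (by omega)⟩

/-! ### Use of the `β`-index -/

/-- If for each `n` there are arbitrarily late `x_m` on which `n` functionals of type II with
pairwise disjoint weights take values at least `ε`, then the `β`-index is not zero. -/
theorem not_betaIndexZero {P : Choices} {x : ℕ → C00} (hx : Successive x) {ε : ℝ} (hε : 0 < ε)
    (h : ∀ n m₀ : ℕ, ∃ m > m₀, ∃ (f : Fin n → C00) (D : Fin n → SpecialData) (a b : Fin n → ℕ+),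
      (∀ j, IsTypeII P (W P) (D j) (a j) (b j) (f j)) ∧
      (∀ i j, i ≠ j → Disjoint ((D i).weights (a i) (b i)) ((D j).weights (a j) (b j))) ∧
      (∀ j, ∀ i ∈ (f j).support, minSupp (x m) ≤ i ∧ i ≤ maxSupp (x m)) ∧
      ∀ j, ε ≤ |act (f j) (x m)|) : ¬ BetaIndexZero P x := by
  intro hβ
  have havg : ∀ n m₀ : ℕ, 1 ≤ n → ∃ m > m₀, ∃ β, IsBetaAverage P (W P) β n ∧
      (∀ i ∈ β.support, minSupp (x m) ≤ i ∧ i ≤ maxSupp (x m)) ∧ ε ≤ act β (x m) := by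
    intro n m₀ hn
    obtain ⟨m, hm, f, D, a, b, h1, h2, h3, h4⟩ := h n m₀
    have hsgn : ∀ j, ∃ f' : C00, (f' = f j ∨ f' = -f j) ∧ ε ≤ act f' (x m) := by
      intro j
      rcases le_abs'.1 (h4 j) with h | h
      · exact ⟨-f j, Or.inr rfl, by rw [act_neg]; linarith⟩
      · exact ⟨f j, Or.inl rfl, h⟩
    choose f' hf' hε' using hsgn
    have htype : ∀ j, IsTypeII P (W P) (D j) (a j) (b j) (f' j) := fun j => by
      rcases hf' j with h | h <;> rw [h]
      exacts [h1 j, (h1 j).neg]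
    have hsupp : ∀ j, (f' j).support = (f j).support := fun j => by
      rcases hf' j with h | h <;> rw [h]
      exact Finsupp.support_neg _
    have hn0 : (0 : ℝ) < n := by exact_mod_cast hn
    refine ⟨m, hm, (1 / n : ℝ) • ∑ j, f' j, ⟨?_, hn, n, f', D, a, b, le_rfl,
      fun j => (htype j).mem_W, htype, h2, rfl⟩, ?_, ?_⟩
    · have := (isNormingClosed_W P).convex n f' (fun _ => 1 / n) (fun j => (htype j).mem_W)
        (fun _ => by positivity) (by simp; field_simp)
      rw [Finset.smul_sum]
      simpa using this
    · intro i hi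
      have hi' := Finsupp.support_finsetSum (Finsupp.support_smul hi)
      simp only [Finset.mem_biUnion, Finset.mem_univ, true_and] at hi'
      obtain ⟨j, hj⟩ := hi'
      exact h3 j i (hsupp j ▸ hj)
    · rw [act_smul, act_sum]
      have : (n : ℝ) * ε ≤ ∑ j, act (f' j) (x m) := by
        simpa using Finset.card_nsmul_le_sum Finset.univ (fun j => act (f' j) (x m)) ε
          (fun j _ => hε' j)
      rw [one_div, inv_mul_eq_div, le_div_iff₀ hn0]
      linarith
  -- A very fast growing sequence of such averages, encoded as triples (average, size, index).
  obtain ⟨T, hT1, hT2⟩ := exists_seq_of_forall_finset_exists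
    (fun t : C00 × ℕ × ℕ => IsBetaAverage P (W P) t.1 t.2.1 ∧
      (∀ i ∈ t.1.support, minSupp (x t.2.2) ≤ i ∧ i ≤ maxSupp (x t.2.2)) ∧
      ε ≤ act t.1 (x t.2.2))
    (fun t t' => t.2.2 < t'.2.2 ∧ 2 ^ (maxSupp t.1 : ℕ) < t'.2.1 ∧ t.2.1 < t'.2.1) (by
      intro s hs
      let n : ℕ := s.sup (fun t => max (2 ^ (maxSupp t.1 : ℕ)) t.2.1) + 1
      obtain ⟨m, hm, β, hβ⟩ := havg n (s.sup fun t => t.2.2) (by omega)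
      refine ⟨(β, n, m), hβ, fun t ht => ⟨?_, ?_⟩⟩
      · exact (Finset.le_sup (f := fun t : C00 × ℕ × ℕ => t.2.2) ht).trans_lt hm
      · have := Finset.le_sup
          (f := fun t : C00 × ℕ × ℕ => max (2 ^ (maxSupp t.1 : ℕ)) t.2.1) ht
        exact max_lt_iff.1 (Nat.lt_succ_of_le this))
  have hne : ∀ q, (T q).1 ≠ 0 := by
    intro q h0
    have := (hT1 q).2.2
    rw [h0, act_zero] at this
    linarith
  have hvfg : VeryFastGrowing (fun q => (T q).2.1) (fun q => (T q).1) := by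
    refine ⟨⟨hne, fun i j hij u hu v hv => ?_⟩, fun i j hij => (hT2 i j hij).2⟩
    have h1 := ((hT1 i).2.1 u hu).2
    have h2 := ((hT1 j).2.1 v hv).1
    exact h1.trans_lt ((hx.2 _ _ (hT2 i j hij).1 _ (maxSupp_mem (hx.1 _)) _
      (minSupp_mem (hx.1 _))).trans_le h2)
  have hlim := hβ 0 (fun q => (T q).1) (fun q => (T q).2.1) (fun q => (hT1 q).1) hvfg
    (fun k => {k}) (fun k => Finset.singleton_nonempty k)
    (fun k l hkl i hi j hj => by
      rw [Finset.mem_singleton.1 hi, Finset.mem_singleton.1 hj]; exact hkl)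
    (fun k => by simp [Admissible, schreier]) (fun q => (T q).2.2) (fun i j hij => (hT2 i j hij).1)
  have : ε ≤ 0 := ge_of_tendsto' hlim fun k => by
    rw [Finset.sum_singleton]
    exact (hT1 k).2.2.trans (le_abs_self _)
  linarith

theorem hyperfilter_eventually_gt (n : ℕ) : ∀ᶠ k in (hyperfilter ℕ : Filter ℕ), n < k :=
  Nat.hyperfilter_le_atTop (eventually_gt_atTop n)

/-! ### Generic families of separating functionals -/

/-- A family of functionals `f k m`, with their representations, that are separating with large
values for generic `k` and `m`. -/
structure IsBadFamily (P : Choices) (x : ℕ → C00) (ε : ℝ) (k₀ : ℕ) (D : ℕ → ℕ → SpecialData)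
    (a b : ℕ → ℕ → ℕ+) (f : ℕ → ℕ → C00) (q₀ : ℕ → ℕ → ℕ) : Prop where
  bad : ∀ᶠ k in (hyperfilter ℕ : Filter ℕ), ∀ᶠ m in (hyperfilter ℕ : Filter ℕ),
    IsBad P x ε k₀ k m (D k m) (a k m) (b k m) (f k m) (q₀ k m)

/-- The special sequences of generic members of the family with the same third vector agree up to
the indices `q₀`. -/
def GenericAgree (D : ℕ → ℕ → SpecialData) (q₀ : ℕ → ℕ → ℕ) : Prop :=
  ∀ᶠ k in (hyperfilter ℕ : Filter ℕ), ∀ᶠ l in (hyperfilter ℕ : Filter ℕ),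
    ∀ᶠ m in (hyperfilter ℕ : Filter ℕ),
      AgreeBelow (D k m) (D l m) (q₀ k m + 1) ∧ AgreeBelow (D k m) (D l m) (q₀ l m + 1)

/-- For generic `k` the index `q₀ k m` is eventually equal to `q k`, and the pairs before it are
eventually those of `S k`. -/
def GenericStable (D : ℕ → ℕ → SpecialData) (q₀ : ℕ → ℕ → ℕ) (S : ℕ → SpecialData) (q : ℕ → ℕ) :
    Prop :=
  ∀ᶠ k in (hyperfilter ℕ : Filter ℕ), ∀ᶠ m in (hyperfilter ℕ : Filter ℕ),
    q₀ k m = q k ∧ AgreeBelow (S k) (D k m) (q k)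

section

variable {P : Choices} {x : ℕ → C00} {ε : ℝ} {k₀ : ℕ} {D : ℕ → ℕ → SpecialData}
  {a b : ℕ → ℕ → ℕ+} {f : ℕ → ℕ → C00} {q₀ : ℕ → ℕ → ℕ} {S : ℕ → SpecialData} {q : ℕ → ℕ}

/-- Generic disjointness of the weights would make the `β`-index positive. -/
theorem IsBadFamily.genericAgree (hx : Successive x) (hε : 0 < ε) (hβ : BetaIndexZero P x)
    (h : IsBadFamily P x ε k₀ D a b f q₀) : GenericAgree D q₀ := by
  let Dis : ℕ → ℕ → ℕ → Prop := fun k l m =>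
    Disjoint (weightsOn (x m) (D k m) (a k m) (b k m)) (weightsOn (x m) (D l m) (a l m) (b l m))
  have hor : ∀ᶠ k in (hyperfilter ℕ : Filter ℕ), ∀ᶠ l in (hyperfilter ℕ : Filter ℕ),
      ∀ᶠ m in (hyperfilter ℕ : Filter ℕ), Dis k l m ∨
        (AgreeBelow (D k m) (D l m) (q₀ k m + 1) ∧ AgreeBelow (D k m) (D l m) (q₀ l m + 1)) := by
    filter_upwards [h.bad] with k hk
    filter_upwards [h.bad] with l hl
    filter_upwards [hk, hl] with m hkm hlm
    exact hkm.disjoint_or_agree hx hlm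
  simp only [Ultrafilter.eventually_or] at hor
  refine hor.resolve_left fun hdis => not_betaIndexZero hx hε (fun n m₀ => ?_) hβ
  obtain ⟨κ, hκ1, hκ2⟩ := exists_seq_of_forall_finset_exists
    (fun k => (∀ᶠ l in (hyperfilter ℕ : Filter ℕ), ∀ᶠ m in (hyperfilter ℕ : Filter ℕ),
      Dis k l m) ∧ ∀ᶠ m in (hyperfilter ℕ : Filter ℕ),
        IsBad P x ε k₀ k m (D k m) (a k m) (b k m) (f k m) (q₀ k m))
    (fun k l => ∀ᶠ m in (hyperfilter ℕ : Filter ℕ), Dis k l m) (by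
      intro s hs
      exact ((hdis.and h.bad).and ((Finset.eventually_all s).2 fun k hk => (hs k hk).1)).exists)
  have h1 : ∀ᶠ m in (hyperfilter ℕ : Filter ℕ), ∀ j ∈ Finset.range n,
      IsBad P x ε k₀ (κ j) m (D (κ j) m) (a (κ j) m) (b (κ j) m) (f (κ j) m) (q₀ (κ j) m) :=
    (Finset.eventually_all _).2 fun j _ => (hκ1 j).2
  have h2 : ∀ᶠ m in (hyperfilter ℕ : Filter ℕ), ∀ i ∈ Finset.range n, ∀ j ∈ Finset.range n,
      i < j → Dis (κ i) (κ j) m := by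
    refine (Finset.eventually_all _).2 fun i _ => (Finset.eventually_all _).2 fun j _ => ?_
    by_cases hij : i < j
    · exact (hκ2 i j hij).mono fun m hm _ => hm
    · exact Eventually.of_forall fun m hc => absurd hc hij
  obtain ⟨m, hm₀, hm1, hm2⟩ := ((hyperfilter_eventually_gt m₀).and (h1.and h2)).exists
  have hmr : ∀ j : Fin n, (j : ℕ) ∈ Finset.range n := fun j => Finset.mem_range.2 j.2
  refine ⟨m, hm₀, fun j => restr (minSupp (x m)) (maxSupp (x m)) (f (κ j) m),
    fun j => D (κ j) m, fun j => max (minSupp (x m)) (a (κ j) m),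
    fun j => min (maxSupp (x m)) (b (κ j) m), ?_, ?_, ?_, ?_⟩
  · exact fun j => (hm1 j (hmr j)).typeII.restr _ _
  · intro i j hij
    rcases lt_or_gt_of_ne hij with hlt | hlt
    · exact hm2 i (hmr i) j (hmr j) hlt
    · exact (hm2 j (hmr j) i (hmr i) hlt).symm
  · intro j i hi
    rw [Finsupp.mem_support_iff, restr_eq_ite] at hi
    by_contra hn
    exact hi (if_neg hn)
  · intro j
    have := (hm1 j (hmr j)).le₃
    rwa [act_congr (g := f (κ j) m)]
    intro i hi
    rw [restr_eq_ite, if_pos ⟨minSupp_le hi, le_maxSupp hi⟩]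

/-- The weights at the indices `q₀ k m` are bounded in `m`, hence generically constant, and weights
determine the earlier pairs. -/
theorem IsBadFamily.exists_stable (hx : Successive x) (hε : 0 < ε)
    (h : IsBadFamily P x ε k₀ D a b f q₀) : ∃ S q, GenericStable D q₀ S q := by
  have key : ∀ᶠ k in (hyperfilter ℕ : Filter ℕ), ∃ t : SpecialData × ℕ,
      ∀ᶠ m in (hyperfilter ℕ : Filter ℕ), q₀ k m = t.2 ∧ AgreeBelow t.1 (D k m) t.2 := by
    filter_upwards [h.bad] with k hk
    obtain ⟨B, hB⟩ := IsBad.weight_lt (P := P) hx hε k₀ k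
    have h1 : ∀ᶠ m in (hyperfilter ℕ : Filter ℕ), ∃ w ∈ Finset.range B,
        (D k m).w (q₀ k m) = w :=
      hk.mono fun m hm => ⟨_, Finset.mem_range.2 (hB hm), rfl⟩
    obtain ⟨w, -, hw⟩ := (Ultrafilter.eventually_exists_mem_iff (Finset.finite_toSet _)).1 h1
    obtain ⟨m', hm', hwm'⟩ := (hk.and hw).exists
    refine ⟨(D k m', q₀ k m'), ?_⟩
    filter_upwards [hk, hw] with m hm hwm
    obtain ⟨he, hagree⟩ := hm'.special.eq_of_weight_eq hm.special (hm'.lt_d hm'.least.1.1)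
      (hm.lt_d hm.least.1.1) (hwm'.trans hwm.symm)
    exact ⟨he.symm, hagree⟩
  obtain ⟨T, hT⟩ := key.choice
  exact ⟨fun k => (T k).1, fun k => (T k).2, hT⟩

end

/-! ### The case of unbounded indices: a special branch -/

theorem pairList_congr {f g f' g' : ℕ → C00} {q : ℕ}
    (h : ∀ i < q, f i = f' i ∧ g i = g' i) : pairList f g q = pairList f' g' q := by
  induction q with
  | zero => simp [pairList]
  | succ q ih =>
    rw [pairList_succ, pairList_succ, ih fun i hi => h i (by omega), (h q (by omega)).1,
      (h q (by omega)).2]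

/-- Being special depends only on the pairs, on the first weight, and on the code. -/
theorem IsSpecial.of_agree {P : Choices} {f g f' g' : ℕ → C00} {w w' : ℕ → ℕ} {d d' : ℕ}
    (h : IsSpecial P (W P) f' g' w' d') (hd : 1 ≤ d) (hdd : d ≤ d')
    (hagree : ∀ i < d, f i = f' i ∧ g i = g' i) (hw0 : w 0 ∈ P.L₁)
    (hf0 : IsTypeIAlpha (W P) (f 0) (w 0)) (hg0 : IsTypeIAlpha (W P) (g 0) (w 0))
    (hw : ∀ q, 0 < q → w q = P.coding (pairList f g q)) : IsSpecial P (W P) f g w d := by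
  have hww : ∀ q, 0 < q → q < d → w q = w' q := fun q h0 hq => by
    rw [hw q h0, pairList_congr fun i hi => hagree i (by omega),
      h.coding_pairList h0 (by omega)]
  refine ⟨hd, fun q hq => ?_, fun q hq => ?_, fun q hq => ?_, fun q hq => ?_, fun q hq => ?_, hw0,
    fun q h0 _ => (hw q h0).symm⟩
  · rcases Nat.eq_zero_or_pos q with rfl | h0
    · exact hf0
    · rw [hww q h0 hq, (hagree q hq).1]
      exact h.typeF q (by omega)
  · rcases Nat.eq_zero_or_pos q with rfl | h0
    · exact hg0
    · rw [hww q h0 hq, (hagree q hq).2]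
      exact h.typeG q (by omega)
  · rw [(hagree q hq).1, (hagree q hq).2]
    exact h.ne_zero q (by omega)
  · rw [(hagree q hq).1, (hagree q hq).2]
    exact h.precFG q (by omega)
  · rw [(hagree q (by omega)).2, (hagree (q + 1) hq).1]
    exact h.precGF q (by omega)

section

variable {P : Choices} {x : ℕ → C00} {ε : ℝ} {k₀ : ℕ} {D : ℕ → ℕ → SpecialData}
  {a b : ℕ → ℕ → ℕ+} {f : ℕ → ℕ → C00} {q₀ : ℕ → ℕ → ℕ} {S : ℕ → SpecialData} {q : ℕ → ℕ}

/-- If `q k → ∞`, the sequences `S k` converge to a special branch. -/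
theorem IsBadFamily.exists_branch (h : IsBadFamily P x ε k₀ D a b f q₀)
    (hagree : GenericAgree D q₀) (hstab : GenericStable D q₀ S q)
    (hq : ∀ p, ∀ᶠ k in (hyperfilter ℕ : Filter ℕ), p < q k) :
    ∃ F G : ℕ → C00, IsBranch P F G ∧ ∀ i, ∀ᶠ l in (hyperfilter ℕ : Filter ℕ),
      (S l).f i = F i ∧ (S l).g i = G i := by
  have hlim : ∀ i, ∃ u v : C00, ∀ᶠ l in (hyperfilter ℕ : Filter ℕ),
      (S l).f i = u ∧ (S l).g i = v := by
    intro i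
    obtain ⟨k, hk1, hk2, hk3⟩ := (hagree.and (hstab.and (hq i))).exists
    refine ⟨(S k).f i, (S k).g i, ?_⟩
    filter_upwards [hk1, hstab, hq i] with l hl1 hl2 hl3
    obtain ⟨m, hm1, ⟨hm2, hm3⟩, hm4, hm5⟩ := (hl1.and (hk2.and hl2)).exists
    have e1 := hm1.1 i (by omega)
    have e2 := hm3 i hk3
    have e3 := hm5 i hl3
    exact ⟨e3.1.trans (e1.1.symm.trans e2.1.symm), e3.2.trans (e1.2.symm.trans e2.2.symm)⟩
  choose F G hFG using hlim
  refine ⟨F, G, ?_, hFG⟩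
  -- Generic members of the family follow the branch for any prescribed length.
  have hfollow : ∀ d, ∃ E : SpecialData, IsSpecial P (W P) E.f E.g E.w E.d ∧ d ≤ E.d ∧
      ∀ i < d, F i = E.f i ∧ G i = E.g i := by
    intro d
    have h1 : ∀ᶠ l in (hyperfilter ℕ : Filter ℕ), ∀ i ∈ Finset.range d,
        (S l).f i = F i ∧ (S l).g i = G i := (Finset.eventually_all _).2 fun i _ => hFG i
    obtain ⟨l, hl1, hl2, hl3, hl4⟩ := (h1.and (h.bad.and (hstab.and (hq d)))).exists
    obtain ⟨m, hm1, hm2, hm3⟩ := (hl2.and hl3).exists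
    have hd := hm1.lt_d hm1.least.1.1
    refine ⟨D l m, hm1.special, by omega, fun i hi => ?_⟩
    have e1 := hl1 i (Finset.mem_range.2 hi)
    have e2 := hm3 i (by omega)
    exact ⟨e1.1.symm.trans e2.1, e1.2.symm.trans e2.2⟩
  obtain ⟨E₀, hE₀, hd₀, hagree₀⟩ := hfollow 1
  let w : ℕ → ℕ := fun i => if i = 0 then E₀.w 0 else P.coding (pairList F G i)
  refine ⟨w, fun d hd => ?_⟩
  obtain ⟨E, hE, hdE, hagreeE⟩ := hfollow d
  have h0 := hagree₀ 0 one_pos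
  refine hE.of_agree hd hdE hagreeE hE₀.weight_first ?_ ?_ ?_
  · rw [h0.1]; exact hE₀.typeF 0 hd₀
  · rw [h0.2]; exact hE₀.typeG 0 hd₀
  · exact fun q h0 => if_neg h0.ne'

/-- Values at `x_k` come from pairs of index at least `q k`, which lie on the branch, as is seen by
comparing with a functional whose second vector is much later than `x_k`. -/
theorem IsBadFamily.false_of_unbounded (hx : Successive x) (hε : 0 < ε) (hB : BranchIndexZero P x)
    (h : IsBadFamily P x ε k₀ D a b f q₀) (hagree : GenericAgree D q₀)
    (hstab : GenericStable D q₀ S q)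
    (hq : ∀ p, ∀ᶠ k in (hyperfilter ℕ : Filter ℕ), p < q k) : False := by
  obtain ⟨F, G, hbranch, hFG⟩ := h.exists_branch hagree hstab hq
  have hN : (0 : ℝ) < (maxSupp (x k₀) : ℕ) := by exact_mod_cast (maxSupp (x k₀)).pos
  obtain ⟨k', p, hsmall⟩ := hB F G hbranch (ε / (maxSupp (x k₀) : ℕ)) (div_pos hε hN)
  obtain ⟨k, hk1, hk2, hk3, hk4, hk5⟩ := (h.bad.and (hagree.and (hstab.and
    ((hyperfilter_eventually_gt k').and (hq p))))).exists
  have h1 : ∀ᶠ l in (hyperfilter ℕ : Filter ℕ), ∀ i ∈ Finset.range (maxSupp (x k)),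
      (S l).f i = F i ∧ (S l).g i = G i := (Finset.eventually_all _).2 fun i _ => hFG i
  obtain ⟨l, hl1, hl2, hl3, hl4⟩ := (hk2.and (hstab.and (h1.and (hq (maxSupp (x k)))))).exists
  obtain ⟨m, hm1, hm2, hm3, hm4⟩ := (hk1.and (hl1.and (hk3.and hl2))).exists
  obtain ⟨r, -, hr1, ⟨i, hi, -, hri⟩, hr2⟩ := hm1.exists_pair hx hε
  have hi' : (i : ℕ) ≤ maxSupp (x k) := le_maxSupp hi
  have e1 := hm2.2 r (by omega)
  have e2 := hm4.2 r (by omega)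
  have e3 := hl3 r (Finset.mem_range.2 (by omega))
  have hf : (D k m).f r = F r := e1.1.trans (e2.1.symm.trans e3.1)
  have hg : (D k m).g r = G r := e1.2.trans (e2.2.symm.trans e3.2)
  rw [hf, hg] at hr2
  have hs := hsmall k hk4.le r (by omega)
  rw [lt_div_iff₀' hN, lt_div_iff₀' hN] at hs
  rcases hr2 with h | h
  · exact h.not_gt hs.1
  · exact h.not_gt hs.2

/-! ### The case of bounded indices: a limit functional -/

/-- If all `q k` equal `p`, the pair of index `p` is responsible for the values at all `x_k`. It
varies with `m` only, and its ultralimit contradicts weak nullness of the sequence. -/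
theorem IsBadFamily.false_of_const (hx : IsBoundedBlock P x) (hε : 0 < ε)
    (h : IsBadFamily P x ε k₀ D a b f q₀) (hagree : GenericAgree D q₀)
    (hstab : GenericStable D q₀ S q) {p : ℕ}
    (hq : ∀ᶠ k in (hyperfilter ℕ : Filter ℕ), q k = p) : False := by
  have hgood := h.bad.and (hstab.and hq)
  obtain ⟨k₁, hk₁, hk₁b, hk₁s, hk₁q⟩ := (hagree.and hgood).exists
  -- The pair of index `p` of generic functionals depends only on the third vector.
  have hsame : ∀ᶠ k in (hyperfilter ℕ : Filter ℕ), ∀ᶠ m in (hyperfilter ℕ : Filter ℕ),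
      IsBad P x ε k₀ k m (D k m) (a k m) (b k m) (f k m) (q₀ k m) ∧ q₀ k m = p ∧
        (D k m).f p = (D k₁ m).f p ∧ (D k m).g p = (D k₁ m).g p := by
    filter_upwards [hk₁, hgood] with k hk1 ⟨hk2, hk3, hk4⟩
    filter_upwards [hk1, hk2, hk3] with m hm1 hm2 hm3
    have hp := hm3.1.trans hk4
    have e := hm1.2 p (by omega)
    exact ⟨hm2, hp, e.1.symm, e.2.symm⟩
  have hlarge : ∀ᶠ k in (hyperfilter ℕ : Filter ℕ), ∀ᶠ m in (hyperfilter ℕ : Filter ℕ),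
      ε ≤ (maxSupp (x k₀) : ℕ) *
        (|act ((D k₁ m).f p) (x k)| + |act ((D k₁ m).g p) (x k)|) := by
    filter_upwards [hsame] with k hk
    obtain ⟨l, hl, hkl⟩ := (hsame.and (hyperfilter_eventually_gt k)).exists
    filter_upwards [hk, hl] with m ⟨hbk, hpk, hfk, hgk⟩ ⟨hbl, hpl, hfl, hgl⟩
    obtain ⟨r, hrF, hr, ⟨i, hi, hir, -⟩, hval⟩ := hbk.exists_pair hx.1 hε
    -- The pair of index `p` meets `ran x_l`, so all later pairs miss `ran x_k`.
    obtain ⟨-, j, hj, hjl⟩ := hbl.least.1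
    rw [hpl, hfl, hgl, ← hfk, ← hgk] at hj
    have hrp : r = p := by
      by_contra hne
      exact absurd (hbk.special.ran_lt (p := p) (by omega) (hbk.lt_d hrF) hj hir)
        (hx.1.lt_of_mem_ran hkl (mem_ran_of_mem_support hi) hjl).le.not_gt
    rw [hrp, hfk, hgk, act_add, act_sub] at hval
    rcases hval with hval | hval
    · exact hval.trans (mul_le_mul_of_nonneg_left (abs_add_le _ _) (Nat.cast_nonneg _))
    · exact hval.trans (mul_le_mul_of_nonneg_left (abs_sub _ _) (Nat.cast_nonneg _))
  have hspec : ∀ᶠ m in (hyperfilter ℕ : Filter ℕ), (D k₁ m).f p ∈ W P ∧ (D k₁ m).g p ∈ W P := by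
    filter_upwards [hk₁b, hk₁s] with m hm1 hm2
    have hp := hm2.1.trans hk₁q
    have hd := hm1.lt_d hm1.least.1.1
    exact ⟨hm1.special.cond_mem_W (q := p) (by omega) false,
      hm1.special.cond_mem_W (q := p) (by omega) true⟩
  obtain ⟨u, hu, hulim⟩ := exists_mem_clW_tendsto (hyperfilter ℕ) (fun m => (D k₁ m).f p)
    (hspec.mono fun m hm => hm.1)
  obtain ⟨v, hv, hvlim⟩ := exists_mem_clW_tendsto (hyperfilter ℕ) (fun m => (D k₁ m).g p)
    (hspec.mono fun m hm => hm.2)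
  have hact : ∀ {φ : ℕ → C00} {u : ℕ+ → ℝ},
      (∀ i, Tendsto (fun m => φ m i) (hyperfilter ℕ : Filter ℕ) (𝓝 (u i))) → ∀ k,
        Tendsto (fun m => act (φ m) (x k)) (hyperfilter ℕ : Filter ℕ) (𝓝 (pair u (x k))) := by
    intro φ u hφ k
    simp only [act_eq_pair, pair]
    exact tendsto_finsetSum _ fun i _ => (hφ i).mul_const _
  have hlimit : ∀ᶠ k in (hyperfilter ℕ : Filter ℕ),
      ε ≤ (maxSupp (x k₀) : ℕ) * (|pair u (x k)| + |pair v (x k)|) := by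
    filter_upwards [hlarge] with k hk
    exact ge_of_tendsto (((hact hulim k).abs.add (hact hvlim k).abs).const_mul _) hk
  have hzero : Tendsto (fun k => ((maxSupp (x k₀) : ℕ) : ℝ) * (|pair u (x k)| + |pair v (x k)|))
      (hyperfilter ℕ : Filter ℕ) (𝓝 0) := by
    have := ((tendsto_pair_of_mem_clW hx hu).abs.add
      (tendsto_pair_of_mem_clW hx hv).abs).const_mul ((maxSupp (x k₀) : ℕ) : ℝ)
    simp only [abs_zero, add_zero, mul_zero] at this
    exact this.mono_left Nat.hyperfilter_le_atTop
  exact absurd (ge_of_tendsto hzero hlimit) hε.not_ge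

/-- A bounded block sequence with zero `β`-index and zero branch index has no such family. -/
theorem not_isBadFamily (hx : IsBoundedBlock P x) (hβ : BetaIndexZero P x)
    (hB : BranchIndexZero P x) (hε : 0 < ε) : ¬ IsBadFamily P x ε k₀ D a b f q₀ := by
  intro h
  have hagree := h.genericAgree hx.1 hε hβ
  obtain ⟨S, q, hstab⟩ := h.exists_stable hx.1 hε
  by_cases hp : ∃ p, ∀ᶠ k in (hyperfilter ℕ : Filter ℕ), q k = p
  · obtain ⟨p, hp⟩ := hp
    exact h.false_of_const hx hε hagree hstab hp
  · refine h.false_of_unbounded hx.1 hε hB hagree hstab fun p => ?_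
    push Not at hp
    have : ∀ᶠ k in (hyperfilter ℕ : Filter ℕ), ∀ i ∈ Finset.range (p + 1), q k ≠ i :=
      (Finset.eventually_all _).2 fun i _ => Ultrafilter.eventually_not.2 (by simpa using hp i)
    filter_upwards [this] with k hk
    by_contra hle
    exact hk (q k) (Finset.mem_range.2 (by omega)) rfl

end

end SpreadHI

open SpreadHI in
theorem mainTheorem10 (P : SpreadHI.Choices) (x : ℕ → SpreadHI.C00)
    (hx : SpreadHI.IsBoundedBlock P x) (hβ : SpreadHI.BetaIndexZero P x)
    (hB : SpreadHI.BranchIndexZero P x) (ε : ℝ) (hε : 0 < ε) :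
    ∃ M : Set ℕ, M.Infinite ∧
      ∀ k₁ ∈ M, ∀ k₂ ∈ M, ∀ k₃ ∈ M, k₁ < k₂ → k₂ < k₃ →
        ∀ f ∈ SpreadHI.W P, SpreadHI.Separates P f (x k₁) (x k₂) (x k₃) →
          |SpreadHI.act f (x k₁)| < ε ∨ |SpreadHI.act f (x k₂)| < ε ∨
            |SpreadHI.act f (x k₃)| < ε := by
  let Good : ℕ → ℕ → ℕ → Prop := fun k₁ k₂ k₃ => ∀ f ∈ W P, Separates P f (x k₁) (x k₂) (x k₃) →
    |act f (x k₁)| < ε ∨ |act f (x k₂)| < ε ∨ |act f (x k₃)| < ε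
  by_cases hgood : ∀ᶠ k₁ in (hyperfilter ℕ : Filter ℕ), ∀ᶠ k₂ in (hyperfilter ℕ : Filter ℕ),
      ∀ᶠ k₃ in (hyperfilter ℕ : Filter ℕ), Good k₁ k₂ k₃
  · exact exists_infinite_of_eventually_triple Good hgood
  exfalso
  simp only [← Ultrafilter.eventually_not] at hgood
  obtain ⟨k₀, hk₀⟩ := hgood.exists
  have hex : ∀ᶠ k in (hyperfilter ℕ : Filter ℕ), ∀ᶠ m in (hyperfilter ℕ : Filter ℕ),
      ∃ t : SpecialData × ℕ+ × ℕ+ × C00 × ℕ,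
        IsBad P x ε k₀ k m t.1 t.2.1 t.2.2.1 t.2.2.2.1 t.2.2.2.2 := by
    filter_upwards [hk₀, hyperfilter_eventually_gt k₀] with k hk hlt₁
    filter_upwards [hk, hyperfilter_eventually_gt k] with m hm hlt₂
    simp only [Good] at hm
    push Not at hm
    obtain ⟨f, -, ⟨D, a, b, htype, hm1, -, hm3, q₀, hleast, hmiss⟩, -, he2, he3⟩ := hm
    exact ⟨(D, a, b, f, q₀), hlt₁, hlt₂, htype, hm1, hm3, hleast, hmiss, he2, he3⟩
  obtain ⟨T, hT⟩ := (hex.mono fun k hk => hk.choice).choice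
  exact not_isBadFamily hx hβ hB hε ⟨hT⟩
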